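/- A graph is finite, simple and undirected. A surface with $h$ handles and $c$ crosscaps has Euler genus $2h+c$, and the Euler genus of a graph is the minimum Euler genus of a surface in which it embeds with no crossings. The radius of a graph $G$ is $\min_{u}\max_{v}\operatorname{dist}_G(u,v)$ over vertices $u,v$ of $G$. The $n\times n$ grid is the graph with vertex set $\{1,\dots,n\}^2$ in which $(x_1,y_1)$ and $(x_2,y_2)$ are adjacent if and only if $|x_1-x_2|+|y_1-y_2|=1$. Proposition. For all integers $g\ge 2$ and $r\ge 1$ there is a graph $G$ with radius at most $r$ and Euler genus at most $g$, such that $G$ is $K_{3,2g+3}$-minor-free (that is, $K_{3,2g+3}$ is not a minor of $G$) and $G$ contains a subgraph isomorphic to the $n\times n$ grid, where $n:=(2r-1)\lfloor\sqrt{g/2}\rfloor$. -/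

import Mathlib

open SimpleGraph

/-- The data for adding `handles` handles and `crosscaps` crosscaps to the sphere `OnePoint ℂ`:
pairwise disjoint closed round discs, two for each handle and one for each crosscap. -/
structure Surface where
  handles : ℕ
  crosscaps : ℕ
  center : (Fin handles × Bool) ⊕ Fin crosscaps → ℂ
  radius : (Fin handles × Bool) ⊕ Fin crosscaps → ℝ
  radius_pos : ∀ i, 0 < radius i
  disjoint_discs : Pairwise fun i j =>
    Disjoint (Metric.closedBall (center i) (radius i)) (Metric.closedBall (center j) (radius j))

namespace Surface

/-- The sphere with the interiors of all the discs removed. -/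
def Holed (S : Surface) : Type :=
  {x : OnePoint ℂ // ∀ i, ∀ w ∈ Metric.ball (S.center i) (S.radius i), x ≠ (w : OnePoint ℂ)}

noncomputable instance (S : Surface) : TopologicalSpace S.Holed :=
  instTopologicalSpaceSubtype

/-- The identifications on the boundary circles. For a handle, the two circles are identified by a
map that reverses the orientation (`z ↦ conj z` on unit complex numbers), so that the result is an
orientable handle; for a crosscap, antipodal points of the circle are identified. -/
inductive Glue (S : Surface) : S.Holed → S.Holed → Prop
  | handle (i : Fin S.handles) (z : ℂ) (hz : ‖z‖ = 1) (x y : S.Holed)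
      (hx : x.1 = ((S.center (.inl (i, false)) + S.radius (.inl (i, false)) * z : ℂ) : OnePoint ℂ))
      (hy : y.1 = ((S.center (.inl (i, true)) +
        S.radius (.inl (i, true)) * (starRingEnd ℂ) z : ℂ) : OnePoint ℂ)) : Glue S x y
  | crosscap (j : Fin S.crosscaps) (z : ℂ) (hz : ‖z‖ = 1) (x y : S.Holed)
      (hx : x.1 = ((S.center (.inr j) + S.radius (.inr j) * z : ℂ) : OnePoint ℂ))
      (hy : y.1 = ((S.center (.inr j) + S.radius (.inr j) * (-z) : ℂ) : OnePoint ℂ)) : Glue S x y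

/-- The closed surface obtained from the sphere by adding the handles and crosscaps, with the
quotient topology. (`Quot` identifies along the equivalence relation generated by `Glue`.) -/
def Space (S : Surface) : Type := Quot S.Glue

noncomputable instance (S : Surface) : TopologicalSpace S.Space :=
  instTopologicalSpaceQuot

/-- The Euler genus of a surface with `h` handles and `c` crosscaps is `2h + c`. -/
def eulerGenus (S : Surface) : ℕ := 2 * S.handles + S.crosscaps

end Surface

namespace SimpleGraph

/-- An embedding, without crossings, of a finite graph in a topological space: vertices are
distinct points, each edge is a simple arc joining its two ends, the interior of an arc contains
no vertex, and the interiors of the arcs of distinct edges are disjoint. -/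
structure Drawing {V : Type*} (G : SimpleGraph V) (X : Type*) [TopologicalSpace X] where
  point : V → X
  arc : G.edgeSet → C(unitInterval, X)
  point_injective : Function.Injective point
  arc_injective : ∀ e, Function.Injective (arc e)
  arc_ends : ∀ e : G.edgeSet, ∃ u v, (e : Sym2 V) = s(u, v) ∧ arc e 0 = point u ∧ arc e 1 = point v
  arc_ne_point : ∀ e, ∀ t ∈ Set.Ioo (0 : unitInterval) 1, ∀ v, arc e t ≠ point v
  arc_ne_arc : ∀ e e', e ≠ e' → ∀ t ∈ Set.Ioo (0 : unitInterval) 1,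
    ∀ t' ∈ Set.Ioo (0 : unitInterval) 1, arc e t ≠ arc e' t'

/-- The Euler genus of a finite graph: the minimum Euler genus of a surface in which it embeds with
no crossings. -/
noncomputable def eulerGenus {V : Type*} (G : SimpleGraph V) : ℕ∞ :=
  ⨅ (S : Surface) (_ : Nonempty (G.Drawing S.Space)), (S.eulerGenus : ℕ∞)

/-- `H` is a minor of `G`: there are pairwise disjoint (nonempty) connected branch sets in `G`,
one for each vertex of `H`, with an edge of `G` between the branch sets of adjacent vertices. -/
def IsMinor {W V : Type*} (H : SimpleGraph W) (G : SimpleGraph V) : Prop :=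
  ∃ B : W → Set V, (∀ u, (G.induce (B u)).Connected) ∧
    (Pairwise fun u v => Disjoint (B u) (B v)) ∧
    ∀ u v, H.Adj u v → ∃ x ∈ B u, ∃ y ∈ B v, G.Adj x y

/-- The `n × m` grid. -/
def gridGraph (n m : ℕ) : SimpleGraph (Fin n × Fin m) where
  Adj p q := |(p.1 : ℤ) - (q.1 : ℤ)| + |(p.2 : ℤ) - (q.2 : ℤ)| = 1
  symm := ⟨fun p q h => by
    rw [abs_sub_comm (q.1 : ℤ), abs_sub_comm (q.2 : ℤ)]; exact h⟩
  loopless := ⟨fun p h => by simp at h⟩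

end SimpleGraph

/-! Put k = ⌊√(g/2)⌋ and ρ = r - 1. Cut the n × n grid into k² blocks of side 2ρ + 1, give every
cell the diagonal that points towards the centre of its block, and add an apex adjacent to the k²
centres. Inside a block the diagonals allow king moves towards the centre, so every grid vertex is
within ρ of a centre and within r of the apex (`radius_blockGraph_le`). The grid is drawn in the
plane and each apex edge gets a handle of its own, so the Euler genus is at most 2k² ≤ g
(`nonempty_drawing`).

Suppose K_{3,t} is a minor with t > 2k² and t ≥ 4. If the apex lies in one of the three branch sets
on the small side, each of the t others is charged to a neighbour of the apex: one that it contains,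
or one whose component, after the apex is deleted from the small-side set, is adjacent to it. Some
neighbour is charged three times. It lies in none of the charging sets, so its component replaces
the small-side set and gives K_{3,3} in the grid. Otherwise at most one of the t sets contains the
apex, and three others give K_{3,3} directly (`not_isMinor_addApex`).

It remains to exclude K_{3,3} from the triangulated grid, which is done algebraically. Faces of a
plane graph can be labelled in an elementary abelian 2-group so that crossing an edge adds a
prescribed even weight (`triangulatedGrid_hasFaceLabellings`). Take as weight the vector of four
cycles spanning the cycle space of the K_{3,3} model. The pairs of labels on the nine linking edges
would then form a dual of K_{3,3}, with a triangle for each of the six vertices; linear algebra over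
𝔽₂ refutes this (`not_even_labelling`). -/

/-! ### Linear algebra over 𝔽₂: no dual of K₃,₃ -/

/-- In an elementary abelian 2-group, three edges `{aⱼ, aⱼ + wⱼ}` with `w₀ + w₁ + w₂ = 0` that
cover every point an even number of times form a triangle; `o` is the fourth point of its coset. -/
theorem triangle_of_even {A : Type*} [AddCommGroup A] [DecidableEq A] (h2 : ∀ a : A, a + a = 0)
    (a w : Fin 3 → A) (hw : ∀ j, w j ≠ 0) (hsum : w 0 + w 1 + w 2 = 0)
    (h : ∀ x, ∑ j, ((if a j = x then 1 else 0) + (if a j + w j = x then 1 else 0) : ZMod 2) = 0) :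
    ∃ o, ∀ j, a j = o + w (j + 1) ∨ a j = o + w (j + 1) + w j := by
  have cancel : ∀ p q : A, p + q + q = p := fun p q => by rw [add_assoc, h2, add_zero]
  have hw2 : w 2 = w 0 + w 1 := by
    have h3 : w 0 + w 1 + w 2 = w 2 + w 2 := by rw [hsum, h2]
    exact (add_right_cancel h3).symm
  -- A point of edge 0 lies on exactly one of edges 1 and 2: no edge is a loop, so each edge covers
  -- a point at most once.
  have parity : ∀ x, (a 0 = x ∨ a 0 + w 0 = x) →
      ((a 1 = x ∨ a 1 + w 1 = x) ∧ ¬ (a 2 = x ∨ a 2 + w 2 = x)) ∨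
      (¬ (a 1 = x ∨ a 1 + w 1 = x) ∧ (a 2 = x ∨ a 2 + w 2 = x)) := by
    intro x hx
    have hn : ∀ j, ¬ (a j = x ∧ a j + w j = x) := fun j hj => hw j (by
      have := hj.2; rw [hj.1] at this; simpa using this)
    have := h x
    rw [Fin.sum_univ_three] at this
    have aux : ∀ (p₀ q₀ p₁ q₁ p₂ q₂ : Prop) [Decidable p₀] [Decidable q₀] [Decidable p₁]
        [Decidable q₁] [Decidable p₂] [Decidable q₂], ¬ (p₀ ∧ q₀) → ¬ (p₁ ∧ q₁) → ¬ (p₂ ∧ q₂) →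
        (p₀ ∨ q₀) → ((if p₀ then 1 else 0) + (if q₀ then 1 else 0) +
          ((if p₁ then 1 else 0) + (if q₁ then 1 else 0)) +
          ((if p₂ then 1 else 0) + (if q₂ then 1 else 0)) : ZMod 2) = 0 →
        ((p₁ ∨ q₁) ∧ ¬ (p₂ ∨ q₂)) ∨ (¬ (p₁ ∨ q₁) ∧ (p₂ ∨ q₂)) := by
      intro p₀ q₀ p₁ q₁ p₂ q₂ _ _ _ _ _ _
      by_cases p₀ <;> by_cases q₀ <;> by_cases p₁ <;> by_cases q₁ <;> by_cases p₂ <;>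
        by_cases q₂ <;> simp [*] <;> decide
    exact aux _ _ _ _ _ _ (hn 0) (hn 1) (hn 2) hx this
  have e0 : ∀ p : A, p + w 0 ≠ p := fun p hp => hw 0 (by simpa using hp)
  have e1 : ∀ p : A, p + w 1 ≠ p := fun p hp => hw 1 (by simpa using hp)
  have h01 : w 0 ≠ w 1 := fun e => hw 2 (by rw [hw2, e, h2])
  rcases parity (a 0) (Or.inl rfl) with ⟨c1, -⟩ | ⟨-, c2⟩
  · have d1 : a 1 = a 0 ∨ a 1 = a 0 + w 1 := c1.imp id fun e => by rw [← e, cancel]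
    have nd : ¬ (a 1 = a 0 + w 0 ∨ a 1 + w 1 = a 0 + w 0) := by
      rcases d1 with d | d <;> rw [d]
      · rintro (e | e)
        · exact e0 _ e.symm
        · exact h01 (add_left_cancel e).symm
      · rw [cancel]
        rintro (e | e)
        · exact h01 (add_left_cancel e).symm
        · exact e0 _ e.symm
    have d2 := ((parity _ (Or.inr rfl)).resolve_left fun t => nd t.1).2
    refine ⟨a 0 + w 2, fun j => ?_⟩
    fin_cases j
    · right
      change a 0 = a 0 + w 2 + w 1 + w 0
      rw [hw2, show a 0 + (w 0 + w 1) + w 1 + w 0 = a 0 + (w 0 + w 0) + (w 1 + w 1) by abel,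
        h2, h2, add_zero, add_zero]
    · change a 1 = a 0 + w 2 + w 2 ∨ a 1 = a 0 + w 2 + w 2 + w 1
      rwa [cancel]
    · change a 2 = a 0 + w 2 + w 0 ∨ a 2 = a 0 + w 2 + w 0 + w 2
      rw [show a 0 + w 2 + w 0 + w 2 = a 0 + w 0 + w 2 + w 2 by abel, cancel]
      refine d2.symm.imp (fun e => ?_) id
      rw [show a 0 + w 2 + w 0 = a 0 + w 0 + w 2 by abel, ← e, cancel]
  · have d2 : a 2 = a 0 ∨ a 2 = a 0 + w 2 := c2.imp id fun e => by rw [← e, cancel]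
    have nd : ¬ (a 2 = a 0 + w 0 ∨ a 2 + w 2 = a 0 + w 0) := by
      have e2 : w 2 ≠ w 0 := fun e => e1 (w 0) (by rw [← hw2, e])
      rcases d2 with d | d <;> rw [d]
      · rintro (e | e)
        · exact e0 _ e.symm
        · exact e2 (add_left_cancel e)
      · rw [cancel]
        rintro (e | e)
        · exact e2 (add_left_cancel e)
        · exact e0 _ e.symm
    have d1 := ((parity _ (Or.inr rfl)).resolve_right fun t => nd t.2).1
    refine ⟨a 0 + w 1, fun j => ?_⟩
    fin_cases j
    · left
      change a 0 = a 0 + w 1 + w 1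
      rw [cancel]
    · change a 1 = a 0 + w 1 + w 2 ∨ a 1 = a 0 + w 1 + w 2 + w 1
      rw [hw2, show a 0 + w 1 + (w 0 + w 1) = a 0 + w 0 + w 1 + w 1 by abel, cancel]
      exact d1.imp id fun e => by rw [← e, cancel]
    · change a 2 = a 0 + w 1 + w 0 ∨ a 2 = a 0 + w 1 + w 0 + w 2
      rw [show a 0 + w 1 + w 0 = a 0 + w 2 by rw [hw2]; abel, cancel]
      exact d2.symm

/-- The edge `ij` of `K₃,₃` in terms of the basis of 4-cycles through the edge `22`. -/
def cycleVector (i j : Fin 3) : Fin 2 → Fin 2 → ZMod 2 := fun p q =>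
  if (i = p.castSucc ∨ i = 2) ∧ (j = q.castSucc ∨ j = 2) then 1 else 0

/-- The dual graph of `K₃,₃` does not exist. -/
theorem not_even_labelling (l : Fin 3 → Fin 3 → Fin 2 → Fin 2 → ZMod 2)
    (row : ∀ i x, ∑ j, ((if l i j = x then 1 else 0) +
      (if l i j + cycleVector i j = x then 1 else 0) : ZMod 2) = 0)
    (col : ∀ j x, ∑ i, ((if l i j = x then 1 else 0) +
      (if l i j + cycleVector i j = x then 1 else 0) : ZMod 2) = 0) : False := by
  have h2 : ∀ a : Fin 2 → Fin 2 → ZMod 2, a + a = 0 := fun a => by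
    funext p q
    exact CharTwo.add_self_eq_zero _
  have hw : ∀ i j, cycleVector i j ≠ 0 := by decide
  choose o ho using fun i => triangle_of_even h2 (l i) (cycleVector i) (hw i)
    (by revert i; decide) (row i)
  choose u hu using fun j => triangle_of_even h2 (fun i => l i j) (fun i => cycleVector i j)
    (fun i => hw i j) (by revert j; decide) (col j)
  -- The row triangle and the column triangle both locate `l i j`, each up to adding `cycleVector i
  -- j`; comparing them determines `o i + u j` up to that ambiguity.
  have ex : ∀ i j, ∃ e : ZMod 2, o i + u j =
      cycleVector i (j + 1) + cycleVector (i + 1) j + e • cycleVector i j := by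
    intro i j
    have h1 : ∃ s : ZMod 2, l i j = o i + cycleVector i (j + 1) + s • cycleVector i j :=
      (ho i j).elim (fun e => ⟨0, by simpa using e⟩) fun e => ⟨1, by simpa using e⟩
    have h3 : ∃ s : ZMod 2, l i j = u j + cycleVector (i + 1) j + s • cycleVector i j :=
      (hu j i).elim (fun e => ⟨0, by simpa using e⟩) fun e => ⟨1, by simpa using e⟩
    obtain ⟨s, hs⟩ := h1
    obtain ⟨t, ht⟩ := h3
    refine ⟨s + t, ?_⟩
    rw [hs] at ht
    funext p q
    have := congrFun (congrFun ht p) q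
    simp only [Pi.add_apply, Pi.smul_apply, smul_eq_mul] at this ⊢
    generalize o i p q = a, u j p q = b, cycleVector i (j + 1) p q = c,
      cycleVector (i + 1) j p q = d, cycleVector i j p q = v at *
    clear hs ht
    revert a b c d v s t
    decide
  choose e he using ex
  -- Summed over the rectangle {i, 2} × {j, 2}, every `o` and every `u` occurs twice and cancels.
  have key : ∀ i j p q,
      (cycleVector i (j + 1) + cycleVector (i + 1) j + e i j • cycleVector i j) p q
      + (cycleVector 2 (j + 1) + cycleVector (2 + 1) j + e 2 j • cycleVector 2 j) p q
      + (cycleVector i (2 + 1) + cycleVector (i + 1) 2 + e i 2 • cycleVector i 2) p q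
      + (cycleVector 2 (2 + 1) + cycleVector (2 + 1) 2 + e 2 2 • cycleVector 2 2) p q = 0 := by
    intro i j p q
    rw [← he, ← he, ← he, ← he]
    simp only [Pi.add_apply]
    generalize o i p q = a, o 2 p q = b, u j p q = c, u 2 p q = d
    revert a b c d
    decide
  -- At these two entries every unknown coefficient except `e 2 2` is multiplied by 0; the first
  -- equation forces `e 2 2 = 0`, the second `e 2 2 = 1`.
  have k1 := key 0 0 1 1
  have k2 := key 0 1 1 0
  simp [cycleVector] at k1 k2
  generalize e 2 2 = d at k1 k2
  clear * - k1 k2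
  revert d
  decide

/-! ### Face labellings exclude K₃,₃ minors -/

namespace SimpleGraph

open Classical in
/-- A mod 2 form of planarity (in the spirit of Mac Lane): every even edge weighting `z` with values
in `A` is the difference of the labels `L`, `R` of the two faces at each edge, for some labelling of
faces; the last clause says that every set of faces has an even boundary. -/
def HasFaceLabellings {V : Type*} [Fintype V] (G : SimpleGraph V) (A : Type*) [AddCommGroup A] :
    Prop :=
  ∀ z : V → V → A, (∀ u v, z u v = z v u) → (∀ u v, z u v ≠ 0 → G.Adj u v) →
    (∀ v, ∑ u, z v u = 0) →
    ∃ L R : V → V → A, (∀ u v, L u v = L v u) ∧ (∀ u v, R u v = R v u) ∧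
      (∀ u v, G.Adj u v → R u v = L u v + z u v) ∧
      ∀ (ψ : A → ZMod 2) (v : V), ∑ u, (if G.Adj v u then ψ (L v u) + ψ (R v u) else 0) = 0

/-- One step of a walk inside `B`. -/
def StepIn {V : Type*} (G : SimpleGraph V) (B : Set V) (x y : V) : Prop :=
  G.Adj x y ∧ x ∈ B ∧ y ∈ B

theorem reflTransGen_stepIn_of_connected {V : Type*} {G : SimpleGraph V} {B : Set V}
    (h : (G.induce B).Connected) {a b : V} (ha : a ∈ B) (hb : b ∈ B) :
    Relation.ReflTransGen (G.StepIn B) a b := by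
  have h1 := (reachable_iff_reflTransGen _ _).1 (h.preconnected ⟨a, ha⟩ ⟨b, hb⟩)
  exact h1.lift (fun x : B => (x : V)) fun x y hxy => ⟨hxy, x.2, y.2⟩

-- Each step of the walk toggles its edge, and the boundaries of consecutive steps telescope mod 2.
open Classical in
theorem exists_chain {V : Type*} [Fintype V] {G : SimpleGraph V} {B : Set V} {a b : V}
    (h : Relation.ReflTransGen (G.StepIn B) a b) :
    ∃ z : V → V → ZMod 2, (∀ u v, z u v = z v u) ∧ (∀ u v, z u v ≠ 0 → G.StepIn B u v) ∧
      ∀ v, ∑ u, z v u = (if v = a then 1 else 0) + (if v = b then 1 else 0) := by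
  induction h with
  | refl => exact ⟨fun _ _ => 0, fun _ _ => rfl, fun _ _ h => (h rfl).elim, fun v => by
      rw [CharTwo.add_self_eq_zero]; simp⟩
  | @tail b c _ hbc ih =>
    obtain ⟨z, hs, hz, hb⟩ := ih
    have hne : b ≠ c := hbc.1.ne
    refine ⟨fun u v => z u v + ((if u = b ∧ v = c then 1 else 0) +
      (if u = c ∧ v = b then 1 else 0)), fun u v => ?_, fun u v h => ?_, fun v => ?_⟩
    · beta_reduce
      rw [hs u v, add_comm (ite (u = b ∧ v = c) _ _)]
      simp only [and_comm]
    · by_cases h1 : u = b ∧ v = c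
      · rw [h1.1, h1.2]; exact hbc
      by_cases h2 : u = c ∧ v = b
      · rw [h2.1, h2.2]; exact ⟨hbc.1.symm, hbc.2.2, hbc.2.1⟩
      simp only [h1, h2, if_false, add_zero] at h
      exact hz _ _ h
    · rw [Finset.sum_add_distrib, hb, Finset.sum_add_distrib]
      simp only [ite_and, Finset.sum_ite_irrel, Finset.sum_ite_eq', Finset.sum_const_zero,
        Finset.mem_univ, if_true]
      have : ∀ p q r : ZMod 2, p + q + (q + r) = p + r := by decide
      exact this _ _ _

/-- A symmetric even weighting has even total weight across every cut. -/
theorem sum_cut_eq_zero {V J : Type*} [Fintype V] [Fintype J] (f : V → V → ZMod 2)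
    (symm : ∀ u v, f u v = f v u) (diag : ∀ v, f v v = 0) (even : ∀ v, ∑ u, f v u = 0)
    (S : Set V) (e : J → V × V) (he : Function.Injective e)
    (hS : ∀ j, (e j).1 ∈ S ∧ (e j).2 ∉ S)
    (supp : ∀ v ∈ S, ∀ u ∉ S, f v u ≠ 0 → ∃ j, e j = (v, u)) :
    ∑ j, f (e j).1 (e j).2 = 0 := by
  classical
  have h0 : ∑ p ∈ S.toFinset ×ˢ Finset.univ, f p.1 p.2 = 0 := by
    rw [Finset.sum_product]
    exact Finset.sum_eq_zero fun v _ => even v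
  have h1 : ∑ p ∈ S.toFinset ×ˢ S.toFinset, f p.1 p.2 = 0 := by
    refine Finset.sum_involution (fun p _ => p.swap) (fun p _ => ?_) (fun p _ hp h => hp ?_)
      (fun p hp => ?_) (fun p _ => p.swap_swap)
    · rw [Prod.fst_swap, Prod.snd_swap, symm, CharTwo.add_self_eq_zero]
    · have : p.2 = p.1 := congrArg Prod.fst h
      rw [this, diag]
    · rw [Finset.mem_product] at hp ⊢
      exact hp.symm
  have h2 : (S.toFinset ×ˢ Finset.univ : Finset (V × V)) =
      S.toFinset ×ˢ S.toFinset ∪ S.toFinset ×ˢ (S.toFinset)ᶜ := by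
    rw [← Finset.product_union, Finset.union_compl]
  rw [h2, Finset.sum_union, h1, zero_add] at h0
  · rw [← h0, ← Finset.sum_image (s := Finset.univ) (g := e) (f := fun p => f p.1 p.2)
      (fun _ _ _ _ h => he h)]
    refine Finset.sum_subset (fun p hp => ?_) fun p hp hp' => ?_
    · obtain ⟨j, -, rfl⟩ := Finset.mem_image.1 hp
      simpa using hS j
    · by_contra hne
      simp only [Finset.mem_product, Set.mem_toFinset, Finset.mem_compl] at hp
      obtain ⟨j, hj⟩ := supp _ hp.1 _ hp.2 hne
      exact hp' (Finset.mem_image.2 ⟨j, Finset.mem_univ _, hj⟩)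
  · rw [Finset.disjoint_left]
    intro p hp hp'
    simp only [Finset.mem_product, Set.mem_toFinset, Finset.mem_compl] at hp hp'
    exact hp'.2 hp.2

/-- A graph with face labellings has no `K₃,₃` minor. -/
theorem HasFaceLabellings.not_K33 {V : Type*} [Fintype V] {G : SimpleGraph V}
    (hG : G.HasFaceLabellings (Fin 2 → Fin 2 → ZMod 2)) (A C : Fin 3 → Set V)
    (hA : ∀ i, ∀ u ∈ A i, ∀ v ∈ A i, Relation.ReflTransGen (G.StepIn (A i)) u v)
    (hC : ∀ i, ∀ u ∈ C i, ∀ v ∈ C i, Relation.ReflTransGen (G.StepIn (C i)) u v)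
    (hAA : ∀ i i' v, v ∈ A i → v ∈ A i' → i = i') (hCC : ∀ j j' v, v ∈ C j → v ∈ C j' → j = j')
    (hAC : ∀ i j v, v ∈ A i → v ∉ C j)
    (hadj : ∀ i j, ∃ a ∈ A i, ∃ b ∈ C j, G.Adj a b) : False := by
  classical
  choose a ha b hb hab using hadj
  choose x xs xz xb using fun i j => exists_chain (hA i (a i 0) (ha i 0) (a i j) (ha i j))
  choose y ys yz yb using fun i j => exists_chain (hC j (b i j) (hb i j) (b 0 j) (hb 0 j))
  choose e es ez eb using fun i j => exists_chain (G := G) (B := {a i j, b i j})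
    (Relation.ReflTransGen.single ⟨hab i j, by simp, by simp⟩ :
      Relation.ReflTransGen (G.StepIn {a i j, b i j}) (a i j) (b i j))
  -- The walk from `a i 0` inside `A i` to `a i j`, across to `b i j`, then inside `C j` to `b 0 j`.
  -- Its start depends only on i and its end only on j.
  set w : Fin 3 → Fin 3 → V → V → ZMod 2 := fun i j u v => x i j u v + y i j u v + e i j u v with hw
  have ws : ∀ i j u v, w i j u v = w i j v u := fun i j u v => by
    simp only [hw]; rw [xs, ys, es]
  have wor : ∀ i j u v, w i j u v ≠ 0 → G.StepIn (A i) u v ∨ G.StepIn (C j) u v ∨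
      G.StepIn {a i j, b i j} u v := by
    intro i j u v h
    by_cases h1 : x i j u v = 0
    · by_cases h2 : y i j u v = 0
      · exact .inr (.inr (ez _ _ _ _ fun h3 => h (by simp [hw, h1, h2, h3])))
      · exact .inr (.inl (yz _ _ _ _ h2))
    · exact .inl (xz _ _ _ _ h1)
  have wz : ∀ i j u v, w i j u v ≠ 0 → G.Adj u v := fun i j u v h => by
    rcases wor i j u v h with h | h | h <;> exact h.1
  have wb : ∀ i j v, ∑ u, w i j v u =
      (if v = a i 0 then 1 else 0) + (if v = b 0 j then 1 else 0) := by
    intro i j v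
    simp only [hw, Finset.sum_add_distrib, xb, yb, eb]
    have : ∀ p q r s : ZMod 2, p + q + (r + s) + (q + r) = p + s := by decide
    exact this _ _ _ _
  have wA : ∀ i j i' u v, u ∈ A i' → v ∉ A i' → w i j u v ≠ 0 → i' = i ∧ u = a i j ∧ v = b i j := by
    intro i j i' u v hu hv h
    rcases wor i j u v h with h | h | h
    · exact (hv (hAA _ _ _ h.2.1 hu ▸ h.2.2)).elim
    · exact (hAC _ _ _ hu h.2.1).elim
    · rcases h.2.1 with rfl | rfl
      · refine ⟨hAA _ _ _ hu (ha i j), rfl, ?_⟩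
        rcases h.2.2 with rfl | rfl
        · exact (hv hu).elim
        · rfl
      · exact (hAC _ _ _ hu (hb i j)).elim
  have wC : ∀ i j j' u v, u ∈ C j' → v ∉ C j' → w i j u v ≠ 0 → j' = j ∧ u = b i j ∧ v = a i j := by
    intro i j j' u v hu hv h
    rcases wor i j u v h with h | h | h
    · exact (hAC _ _ _ h.2.1 hu).elim
    · exact (hv (hCC _ _ _ h.2.1 hu ▸ h.2.2)).elim
    · rcases h.2.1 with rfl | rfl
      · exact (hAC _ _ _ (ha i j) hu).elim
      · refine ⟨hCC _ _ _ hu (hb i j), rfl, ?_⟩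
        rcases h.2.2 with rfl | rfl
        · rfl
        · exact (hv hu).elim
  have w1 : ∀ i j, w i j (a i j) (b i j) = 1 := by
    intro i j
    have nA : b i j ∉ A i := fun h => hAC _ _ _ h (hb i j)
    have hx : x i j (a i j) (b i j) = 0 := by
      by_contra h; exact nA (xz _ _ _ _ h).2.2
    have hy : y i j (a i j) (b i j) = 0 := by
      by_contra h; exact hAC _ _ _ (ha i j) (yz _ _ _ _ h).2.1
    have hs := eb i j (a i j)
    rw [if_pos rfl, if_neg (hab i j).ne, add_zero, Finset.sum_eq_single (b i j)] at hs
    · simp only [hw, hx, hy, hs, zero_add]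
    · intro u _ hu
      by_contra h
      rcases (ez _ _ _ _ h).2.2 with rfl | rfl
      · exact (ez _ _ _ _ h).1.ne rfl
      · exact hu rfl
    · simp
  have wval : ∀ i j i' j', w i' j' (a i j) (b i j) = if i = i' ∧ j = j' then 1 else 0 := by
    intro i j i' j'
    split_ifs with h
    · rw [← h.1, ← h.2, w1]
    · by_contra h0
      obtain ⟨h1, -, h2⟩ := wA _ _ _ _ _ (ha i j) (fun h => hAC _ _ _ h (hb i j)) h0
      exact h ⟨h1, hCC _ _ _ (hb i j) (h2 ▸ hb i' j')⟩
  -- Coordinate (p, q) lifts the 4-cycle on rows {p, 2} and columns {q, 2}: each end of the four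
  -- walks occurs twice, so the boundary vanishes. On the linking edge ij the value is `cycleVector
  -- i j`.
  set z : V → V → Fin 2 → Fin 2 → ZMod 2 := fun u v p q =>
    w p.castSucc q.castSucc u v + w p.castSucc 2 u v + w 2 q.castSucc u v + w 2 2 u v with hz
  have zor : ∀ u v, z u v ≠ 0 → ∃ i j, w i j u v ≠ 0 := by
    intro u v h
    by_contra! h0
    exact h (by funext p q; simp [hz, h0])
  have zval : ∀ i j, z (a i j) (b i j) = cycleVector i j := by
    intro i j
    funext p q
    simp only [hz, wval, cycleVector]
    revert i j p q
    decide
  obtain ⟨L, R, hL, hR, hLR, hψ⟩ := hG z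
    (fun u v => by funext p q; simp only [hz]; rw [ws, ws _ 2, ws 2, ws 2 2])
    (fun u v h => by obtain ⟨i, j, h⟩ := zor u v h; exact wz _ _ _ _ h)
    (fun v => by
      funext p q
      simp only [hz, Finset.sum_apply, Finset.sum_add_distrib, wb, Pi.zero_apply]
      have : ∀ s t s' t' : ZMod 2, s + t + (s + t') + (s' + t) + (s' + t') = 0 := by decide
      exact this _ _ _ _)
  -- The boundary of the set of faces labelled `c`. It is even at every vertex, and vanishes where
  -- `z` does since both sides then have the same label.
  let f : (Fin 2 → Fin 2 → ZMod 2) → V → V → ZMod 2 := fun c u v =>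
    if G.Adj u v then (if L u v = c then 1 else 0) + (if R u v = c then 1 else 0) else 0
  have fs : ∀ c u v, f c u v = f c v u := fun c u v => by
    simp only [f, hL u v, hR u v, G.adj_comm u v]
  have fd : ∀ c v, f c v v = 0 := fun c v => if_neg (G.irrefl)
  have fe : ∀ c v, ∑ u, f c v u = 0 := fun c v => hψ (fun d => if d = c then 1 else 0) v
  have fz : ∀ c u v, f c u v ≠ 0 → ∃ i j, w i j u v ≠ 0 := by
    intro c u v h
    apply zor
    intro h0
    apply h
    by_cases h1 : G.Adj u v
    · simp only [f, if_pos h1, hLR _ _ h1, h0, add_zero]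
      exact CharTwo.add_self_eq_zero _
    · exact if_neg h1
  have fval : ∀ i j c, f c (a i j) (b i j) = (if L (a i j) (b i j) = c then 1 else 0) +
      (if L (a i j) (b i j) + cycleVector i j = c then 1 else 0) := by
    intro i j c
    simp only [f, if_pos (hab i j), hLR _ _ (hab i j), zval]
  -- Among the edges leaving `A i` (or `C j`), `f c` can be nonzero only on the three linking edges,
  -- so the parity of the cut is a row (or column) condition.
  refine not_even_labelling (fun i j => L (a i j) (b i j)) (fun i c => ?_) fun j c => ?_
  · simp only [← fval]
    refine sum_cut_eq_zero (f c) (fs c) (fd c) (fe c) (A i) (fun j => (a i j, b i j))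
      (fun j j' h => ?_) (fun j => ⟨ha i j, fun h => hAC _ _ _ h (hb i j)⟩) fun v hv u hu h => ?_
    · exact hCC _ _ _ (hb i j) ((Prod.mk.inj h).2 ▸ hb i j')
    · obtain ⟨i', j, h⟩ := fz _ _ _ h
      obtain ⟨rfl, rfl, rfl⟩ := wA _ _ _ _ _ hv hu h
      exact ⟨j, rfl⟩
  · simp only [← fval]
    simp only [fs c (a _ j)]
    refine sum_cut_eq_zero (f c) (fs c) (fd c) (fe c) (C j) (fun i => (b i j, a i j))
      (fun i i' h => ?_) (fun i => ⟨hb i j, hAC _ _ _ (ha i j)⟩) fun v hv u hu h => ?_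
    · exact hAA _ _ _ (ha i j) ((Prod.mk.inj h).2 ▸ ha i' j)
    · obtain ⟨i, j', h⟩ := fz _ _ _ h
      obtain ⟨rfl, rfl, rfl⟩ := wC _ _ _ _ _ hv hu h
      exact ⟨i, rfl⟩

end SimpleGraph

/-! ### Faces of the triangulated grid -/

namespace SimpleGraph

/-- The edges of the square lattice with one diagonal in each cell, directed to the right (the
vertical ones upwards); `d x y` says that the diagonal of the cell with upper right corner `(x, y)`
is the rising one. -/
def LatticeStep (d : ℕ → ℕ → Prop) (p q : ℕ × ℕ) : Prop :=
  (q.1 = p.1 + 1 ∧ q.2 = p.2) ∨ (q.1 = p.1 ∧ q.2 = p.2 + 1) ∨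
    (q.1 = p.1 + 1 ∧ q.2 = p.2 + 1 ∧ d q.1 q.2) ∨ (q.1 = p.1 + 1 ∧ p.2 = q.2 + 1 ∧ ¬ d q.1 p.2)

/-- The `n × n` grid with one diagonal in each cell. -/
def triangulatedGrid (d : ℕ → ℕ → Prop) (n : ℕ) : SimpleGraph (Fin n × Fin n) where
  Adj u v := LatticeStep d (u.1, u.2) (v.1, v.2) ∨ LatticeStep d (v.1, v.2) (u.1, u.2)
  symm := ⟨fun _ _ h => h.symm⟩
  loopless := ⟨fun u h => by simp [LatticeStep] at h⟩

section Faces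

variable {A : Type*} [AddCommGroup A] (dd : ℕ → ℕ → Prop) (h v c : ℕ → ℕ → A)

/-- Label of the lower triangle of the cell with upper right corner `(x, y)`, given the weights
`h`, `v`, `c` of the horizontal, vertical and diagonal edges: the total weight of the edges of its
column below it. -/
def lowerFace (x y : ℕ) : A := ∑ t ∈ Finset.range y, (h x t + c x t)

def upperFace (x y : ℕ) : A := lowerFace h c x y + c x y

open Classical in
noncomputable def rightFace (x y : ℕ) : A := if dd x y then lowerFace h c x y else upperFace h c x y

open Classical in
noncomputable def leftFace (x y : ℕ) : A := if dd x y then upperFace h c x y else lowerFace h c x y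

theorem lowerFace_succ (x y : ℕ) : lowerFace h c x (y + 1) = upperFace h c x y + h x y := by
  simp only [lowerFace, upperFace, Finset.sum_range_succ]
  abel

-- Column sums make the labels change correctly across horizontal and diagonal edges by
-- construction. Across vertical edges this is propagated upwards: evenness at the vertex (x, y)
-- carries the relation below it to the one above it, starting from the weightless row 0.
open Classical in
theorem leftFace_eq (h2 : ∀ a : A, a + a = 0) (hv : ∀ x, v x 0 = 0) (hc : ∀ x, c x 0 = 0)
    (even : ∀ x y, h x y + h (x + 1) y + v x y + v x (y + 1) + (if dd x y then c x y else 0) +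
      (if dd (x + 1) (y + 1) then c (x + 1) (y + 1) else 0) +
      (if dd (x + 1) y then 0 else c (x + 1) y) + (if dd x (y + 1) then 0 else c x (y + 1)) = 0)
    (x y : ℕ) : leftFace dd h c (x + 1) y = rightFace dd h c x y + v x y := by
  have neg : ∀ a : A, -a = a := fun a => neg_eq_of_add_eq_zero_left (h2 a)
  induction y with
  | zero => simp [leftFace, rightFace, lowerFace, upperFace, hv, hc]
  | succ y ih =>
    have e := even x y
    simp only [leftFace, rightFace, upperFace, lowerFace_succ] at ih ⊢
    generalize lowerFace h c x y = a, lowerFace h c (x + 1) y = b at *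
    have e' : v x (y + 1) = h x y + h (x + 1) y + v x y + (if dd x y then c x y else 0) +
      (if dd (x + 1) (y + 1) then c (x + 1) (y + 1) else 0) +
      (if dd (x + 1) y then 0 else c (x + 1) y) + (if dd x (y + 1) then 0 else c x (y + 1)) := by
      refine (eq_neg_of_add_eq_zero_left (Eq.trans ?_ e)).trans (neg _)
      abel
    have ih' : b = a + v x y + (if dd x y then 0 else c x y) +
        (if dd (x + 1) y then c (x + 1) y else 0) := by
      have := congrArg (fun t => t + (if dd (x + 1) y then c (x + 1) y else 0)) ih
      split_ifs at this ⊢ <;> simp only [add_zero, add_assoc, h2] at this ⊢ <;> rw [this] <;> abel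
    have two : ∀ a : A, (2 : ℤ) • a = 0 := fun a => by rw [two_zsmul, h2]
    rw [e', ih']
    split_ifs <;> abel_nf <;> simp only [two, add_zero, zero_add]

open Classical in
/-- Every set of faces has an even boundary at the vertex `(x, y)`. -/
theorem sum_face_changes (ψ : A → ZMod 2) (x y : ℕ) :
    (ψ (upperFace h c x y) + ψ (lowerFace h c x (y + 1))) +
    (ψ (upperFace h c (x + 1) y) + ψ (lowerFace h c (x + 1) (y + 1))) +
    (ψ (rightFace dd h c x y) + ψ (leftFace dd h c (x + 1) y)) +
    (ψ (rightFace dd h c x (y + 1)) + ψ (leftFace dd h c (x + 1) (y + 1))) +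
    (if dd x y then ψ (lowerFace h c x y) + ψ (upperFace h c x y) else 0) +
    (if dd (x + 1) (y + 1) then
      ψ (lowerFace h c (x + 1) (y + 1)) + ψ (upperFace h c (x + 1) (y + 1)) else 0) +
    (if dd (x + 1) y then 0 else ψ (lowerFace h c (x + 1) y) + ψ (upperFace h c (x + 1) y)) +
    (if dd x (y + 1) then 0 else
      ψ (lowerFace h c x (y + 1)) + ψ (upperFace h c x (y + 1))) = 0 := by
  -- Around the vertex each face value occurs an even number of times, once for each edge of that
  -- face at the vertex.
  simp only [rightFace, leftFace, apply_ite ψ]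
  generalize ψ (lowerFace h c x y) = p1, ψ (upperFace h c x y) = p2,
    ψ (lowerFace h c (x + 1) y) = p3, ψ (upperFace h c (x + 1) y) = p4,
    ψ (lowerFace h c x (y + 1)) = p5, ψ (upperFace h c x (y + 1)) = p6,
    ψ (lowerFace h c (x + 1) (y + 1)) = p7, ψ (upperFace h c (x + 1) (y + 1)) = p8
  have two : (2 : ZMod 2) = 0 := rfl
  split_ifs <;> ring_nf <;> simp only [two, mul_zero, add_zero]

end Faces

end SimpleGraph

/-! ### The triangulated grid has face labellings -/

namespace SimpleGraph

/-- Whatever the diagonals, the neighbours of a lattice point are among its eight surrounding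
points. Requiring `f` to vanish off the grid makes border vertices no exception. -/
theorem sum_lattice_neighbours {M : Type*} [AddCommMonoid M] {n : ℕ} (d : ℕ → ℕ → Prop)
    (f : ℕ × ℕ → M) (x y : ℕ)
    (hd : ∀ q, f q ≠ 0 → LatticeStep d (x + 1, y + 1) q ∨ LatticeStep d q (x + 1, y + 1))
    (hn : ∀ q, f q ≠ 0 → ∃ u : Fin n × Fin n, (u.1.val + 1, u.2.val + 1) = q) :
    ∑ u : Fin n × Fin n, f (u.1 + 1, u.2 + 1) = f (x, y + 1) + f (x + 2, y + 1) + f (x + 1, y) +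
      f (x + 1, y + 2) + f (x, y) + f (x + 2, y + 2) + f (x + 2, y) + f (x, y + 2) := by
  classical
  have inj : Function.Injective fun u : Fin n × Fin n => (u.1.val + 1, u.2.val + 1) := by
    rintro ⟨a, b⟩ ⟨a', b'⟩ h
    simpa [Fin.ext_iff] using h
  have cover : ∀ q, f q ≠ 0 → q ∈ ({(x, y + 1), (x + 2, y + 1), (x + 1, y), (x + 1, y + 2), (x, y),
      (x + 2, y + 2), (x + 2, y), (x, y + 2)} : Finset (ℕ × ℕ)) := by
    rintro ⟨a, b⟩ h
    have := hd _ h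
    simp only [LatticeStep] at this
    simp only [Finset.mem_insert, Finset.mem_singleton, Prod.mk.injEq]
    omega
  have key : ∑ u : Fin n × Fin n, f (u.1 + 1, u.2 + 1) =
      ∑ q ∈ ({(x, y + 1), (x + 2, y + 1), (x + 1, y), (x + 1, y + 2), (x, y),
      (x + 2, y + 2), (x + 2, y), (x, y + 2)} : Finset (ℕ × ℕ)), f q := by
    rw [← Finset.sum_image (s := Finset.univ) (g := fun u : Fin n × Fin n => (u.1.val + 1, u.2.val + 1))
      (f := f) inj.injOn]
    rw [← Finset.sum_filter_ne_zero, ← Finset.sum_filter_ne_zero (s := insert _ _)]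
    refine Finset.sum_congr (Finset.ext fun q => ?_) fun _ _ => rfl
    rw [Finset.mem_filter, Finset.mem_filter]
    refine and_congr_left fun h => iff_of_true ?_ (cover q h)
    obtain ⟨u, hu⟩ := hn q h
    exact Finset.mem_image.2 ⟨u, Finset.mem_univ _, hu⟩
  rw [key]
  repeat rw [Finset.sum_insert (by simp [Prod.mk.injEq])]
  rw [Finset.sum_singleton]
  simp only [add_assoc]

theorem triangulatedGrid_hasFaceLabellings (d : ℕ → ℕ → Prop) (n : ℕ) (A : Type*)
    [AddCommGroup A] (h2 : ∀ a : A, a + a = 0) :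
    (triangulatedGrid d n).HasFaceLabellings A := by
  classical
  intro z zs zz ze
  -- Shifting by one leaves row 0 and column 0 as a margin without edges, so the truncated
  -- subtractions below produce only zero weights there.
  let ι : Fin n × Fin n → ℕ × ℕ := fun u => (u.1 + 1, u.2 + 1)
  have inj : Function.Injective ι := by
    rintro ⟨a, b⟩ ⟨a', b'⟩ h
    simpa [ι, Fin.ext_iff] using h
  obtain ⟨d', hd'⟩ : ∃ d' : ℕ → ℕ → Prop, ∀ x y, d' (x + 1) (y + 1) = d x y :=
    ⟨fun x y => d (x - 1) (y - 1), fun _ _ => rfl⟩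
  have stepι : ∀ u v, LatticeStep d (u.1, u.2) (v.1, v.2) ↔ LatticeStep d' (ι u) (ι v) := by
    intro u v
    simp only [LatticeStep, ι, hd', Nat.add_right_cancel_iff]
  obtain ⟨Z, Zι, Z0⟩ : ∃ Z : ℕ × ℕ → ℕ × ℕ → A, (∀ u v, Z (ι u) (ι v) = z u v) ∧
      ∀ p q, Z p q ≠ 0 → ∃ u v, p = ι u ∧ q = ι v := by
    refine ⟨fun p q => Function.extend (Prod.map ι ι) (Function.uncurry z) 0 (p, q),
      fun u v => (inj.prodMap inj).extend_apply _ _ (u, v), fun p q h => ?_⟩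
    by_contra hc
    refine h (Function.extend_apply' _ _ _ ?_)
    rintro ⟨⟨u, v⟩, huv⟩
    exact hc ⟨u, v, (congrArg Prod.fst huv).symm, (congrArg Prod.snd huv).symm⟩
  have Zs : ∀ p q, Z p q = Z q p := by
    intro p q
    by_cases h : ∃ u v, p = ι u ∧ q = ι v
    · obtain ⟨u, v, rfl, rfl⟩ := h
      rw [Zι, Zι, zs]
    · rw [not_ne_iff.1 (mt (Z0 p q) h), not_ne_iff.1 (mt (Z0 q p) fun ⟨u, v, e⟩ => h ⟨v, u, e.symm⟩)]
  have Zadj : ∀ p q, Z p q ≠ 0 → LatticeStep d' p q ∨ LatticeStep d' q p := by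
    intro p q h
    obtain ⟨u, v, rfl, rfl⟩ := Z0 p q h
    rw [Zι] at h
    rw [← stepι, ← stepι]
    exact zz u v h
  have Zx : ∀ y q, Z (0, y) q = 0 := fun y q => by
    by_contra h
    obtain ⟨u, v, e, -⟩ := Z0 _ _ h
    simp [ι] at e
  have Zy : ∀ x q, Z (x, 0) q = 0 := fun x q => by
    by_contra h
    obtain ⟨u, v, e, -⟩ := Z0 _ _ h
    simp [ι] at e
  have Zx' : ∀ y q, Z q (0, y) = 0 := fun y q => by rw [Zs, Zx]
  have Zy' : ∀ x q, Z q (x, 0) = 0 := fun x q => by rw [Zs, Zy]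
  let h : ℕ → ℕ → A := fun x y => Z (x - 1, y) (x, y)
  let v : ℕ → ℕ → A := fun x y => Z (x, y - 1) (x, y)
  let c : ℕ → ℕ → A := fun x y =>
    if d' x y then Z (x - 1, y - 1) (x, y) else Z (x - 1, y) (x, y - 1)
  have hlf := leftFace_eq d' h v c h2 (fun x => Zy' _ _)
    (fun x => by simp only [c, Zy, ite_self]) (fun x y => by
      rcases x with - | x
      · simp only [h, v, c, Zx, Nat.zero_sub, ite_self, add_zero, zero_add, Nat.add_sub_cancel]
      rcases y with - | y
      · simp only [h, v, c, Zy, Zy', Nat.zero_sub, ite_self, add_zero, zero_add, Nat.add_sub_cancel]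
      have e : ∑ u, Z (x + 1, y + 1) (ι u) = 0 := by
        by_cases hp : ∃ w, (x + 1, y + 1) = ι w
        · obtain ⟨w, hw⟩ := hp
          simp only [hw, Zι, ze]
        · refine Finset.sum_eq_zero fun u _ => not_ne_iff.1 fun hu => hp ?_
          obtain ⟨w, -, hw, -⟩ := Z0 _ _ hu
          exact ⟨w, hw⟩
      rw [sum_lattice_neighbours d' (Z (x + 1, y + 1)) x y (fun q hq => Zadj _ _ hq)
        fun q hq => (Z0 _ _ hq).elim fun _ ⟨w, _, hw⟩ => ⟨w, hw.symm⟩] at e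
      have c1 : (if d' (x + 1) (y + 1) then c (x + 1) (y + 1) else 0) =
          Z (x + 1, y + 1) (x, y) := by
        split_ifs with hd
        · simp only [c, if_pos hd, Nat.add_sub_cancel, Zs (x, y)]
        · by_contra hz
          have := Zadj _ _ (Ne.symm hz)
          simp only [LatticeStep] at this
          grind
      have c2 : (if d' (x + 1 + 1) (y + 1 + 1) then c (x + 1 + 1) (y + 1 + 1) else 0) =
          Z (x + 1, y + 1) (x + 2, y + 2) := by
        split_ifs with hd
        · simp only [c, if_pos hd, Nat.add_sub_cancel]
        · by_contra hz
          have := Zadj _ _ (Ne.symm hz)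
          simp only [LatticeStep] at this
          grind
      have c3 : (if d' (x + 1 + 1) (y + 1) then 0 else c (x + 1 + 1) (y + 1)) =
          Z (x + 1, y + 1) (x + 2, y) := by
        split_ifs with hd
        · by_contra hz
          have := Zadj _ _ (Ne.symm hz)
          simp only [LatticeStep] at this
          grind
        · simp only [c, if_neg hd, Nat.add_sub_cancel]
      have c4 : (if d' (x + 1) (y + 1 + 1) then 0 else c (x + 1) (y + 1 + 1)) =
          Z (x + 1, y + 1) (x, y + 2) := by
        split_ifs with hd
        · by_contra hz
          have := Zadj _ _ (Ne.symm hz)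
          simp only [LatticeStep] at this
          grind
        · simp only [c, if_neg hd, Nat.add_sub_cancel, Zs (x, _)]
      rw [c1, c2, c3, c4, ← e]
      simp only [h, v, Nat.add_sub_cancel, Zs (x, y + 1), Zs (x + 1, y)])
  -- `F₁` and `F₂` are the faces on the two sides of an edge: below and above a horizontal one, left
  -- and right of a vertical one, under and over a diagonal. The maxima give the upper right corner
  -- of the relevant cell, whichever way the edge is directed.
  let F₁ : ℕ × ℕ → ℕ × ℕ → A := fun p q =>
    if p.2 = q.2 then upperFace h c (max p.1 q.1) (max p.2 q.2)
    else if p.1 = q.1 then rightFace d' h c (max p.1 q.1) (max p.2 q.2)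
    else lowerFace h c (max p.1 q.1) (max p.2 q.2)
  let F₂ : ℕ × ℕ → ℕ × ℕ → A := fun p q =>
    if p.2 = q.2 then lowerFace h c (max p.1 q.1) (max p.2 q.2 + 1)
    else if p.1 = q.1 then leftFace d' h c (max p.1 q.1 + 1) (max p.2 q.2)
    else upperFace h c (max p.1 q.1) (max p.2 q.2)
  have F₁s : ∀ p q, F₁ p q = F₁ q p := fun p q => by
    simp only [F₁, max_comm, eq_comm]
  have F₂s : ∀ p q, F₂ p q = F₂ q p := fun p q => by
    simp only [F₂, max_comm, eq_comm]
  have Fstep : ∀ p q, LatticeStep d' p q → F₂ p q = F₁ p q + Z p q := by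
    rintro ⟨x, y⟩ ⟨x', y'⟩ hs
    simp only [LatticeStep] at hs
    rcases hs with ⟨rfl, rfl⟩ | ⟨rfl, rfl⟩ | ⟨rfl, rfl, hd⟩ | ⟨rfl, rfl, hd⟩
    · simp [F₁, F₂, lowerFace_succ, h]
    · simp [F₁, F₂, hlf, v]
    · simp [F₁, F₂, upperFace, c, hd]
    · simp [F₁, F₂, upperFace, c, hd]
  refine ⟨fun u v => F₁ (ι u) (ι v), fun u v => F₂ (ι u) (ι v), fun u v => F₁s _ _,
    fun u v => F₂s _ _, fun u v huv => ?_, fun ψ w => ?_⟩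
  · rw [← Zι]
    rcases huv with huv | huv
    · exact Fstep _ _ ((stepι _ _).1 huv)
    · beta_reduce
      rw [F₁s, F₂s, Zs]
      exact Fstep _ _ ((stepι _ _).1 huv)
  · let f : ℕ × ℕ → ZMod 2 := fun q =>
      if LatticeStep d' (ι w) q ∨ LatticeStep d' q (ι w) then ψ (F₁ (ι w) q) + ψ (F₂ (ι w) q) else 0
    have hf : ∀ u, (if (triangulatedGrid d n).Adj w u then
        ψ (F₁ (ι w) (ι u)) + ψ (F₂ (ι w) (ι u)) else 0) = f (ι u) := fun u => by
      simp only [f, ← stepι]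
      exact if_congr Iff.rfl rfl rfl
    rw [Finset.sum_congr rfl fun u _ => hf u]
    rw [sum_lattice_neighbours d' f w.1 w.2 (fun q hq => by_contra fun hc => hq (if_neg hc))]
    · rw [← sum_face_changes d' h c ψ (w.1 + 1) (w.2 + 1)]
      have ne2 : ∀ t : ℕ, ¬ t = t + 1 + 1 := by omega
      obtain ⟨x, y⟩ := w
      have pos : ∀ q, (LatticeStep d' (ι (x, y)) q ∨ LatticeStep d' q (ι (x, y))) →
        f q = ψ (F₁ (ι (x, y)) q) + ψ (F₂ (ι (x, y)) q) := fun q hq => if_pos hq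
      have neg : ∀ q, ¬ (LatticeStep d' (ι (x, y)) q ∨ LatticeStep d' q (ι (x, y))) →
        f q = 0 := fun q hq => if_neg hq
      congr 1
      · congr 1
        · congr 1
          · congr 1
            · congr 1
              · congr 1
                · congr 1
                  · rw [pos _ (by simp [LatticeStep, ι])]
                    simp [F₁, F₂, ι]
                  · rw [pos _ (by simp [LatticeStep, ι])]
                    simp [F₁, F₂, ι]
                · rw [pos _ (by simp [LatticeStep, ι])]
                  simp [F₁, F₂, ι]
              · rw [pos _ (by simp [LatticeStep, ι])]
                simp [F₁, F₂, ι]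
            · split_ifs with hd
              · rw [pos _ (by simp [LatticeStep, ι, hd])]
                simp [F₁, F₂, ι]
              · rw [neg _ (by simp [LatticeStep, ι, hd, ne2])]
          · split_ifs with hd
            · rw [pos _ (by simp [LatticeStep, ι, hd])]
              simp [F₁, F₂, ι]
            · rw [neg _ (by simp [LatticeStep, ι, hd])]
        · split_ifs with hd
          · rw [neg _ (by simp [LatticeStep, ι, hd, ne2])]
          · rw [pos _ (by simp [LatticeStep, ι, hd])]
            simp [F₁, F₂, ι]
      · split_ifs with hd
        · rw [neg _ (by simp [LatticeStep, ι, hd, ne2])]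
        · rw [pos _ (by simp [LatticeStep, ι, hd])]
          simp [F₁, F₂, ι]
    · intro q hq
      by_contra hc
      apply hq
      -- A lattice edge leaving the grid has weight 0, hence equal labels on both sides, and
      -- contributes nothing.
      by_cases hs : LatticeStep d' (ι w) q ∨ LatticeStep d' q (ι w)
      · have hz : Z (ι w) q = 0 := by
          by_contra hz
          obtain ⟨-, u, -, rfl⟩ := Z0 _ _ hz
          exact hc ⟨u, rfl⟩
        have : F₂ (ι w) q = F₁ (ι w) q := by
          rcases hs with hs | hs
          · rw [Fstep _ _ hs, hz, add_zero]
          · rw [F₂s, F₁s, Fstep _ _ hs, Zs, hz, add_zero]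
        simp only [f, this]
        rw [CharTwo.add_self_eq_zero, ite_self]
      · exact if_neg hs

end SimpleGraph

/-! ### K₃,ₜ minors in a graph with an apex -/

namespace SimpleGraph

/-- The graph obtained from `T` by adding a vertex `none` adjacent to the vertices in `N`. -/
def addApex {U : Type*} (T : SimpleGraph U) (N : Set U) : SimpleGraph (Option U) where
  Adj x y := match x, y with
    | none, none => False
    | none, some v => v ∈ N
    | some u, none => u ∈ N
    | some u, some v => T.Adj u v
  symm := ⟨fun x y h => by
    rcases x with - | u <;> rcases y with - | v
    exacts [h, h, h, T.adj_symm h]⟩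
  loopless := ⟨fun x h => by
    rcases x with - | u
    exacts [h, T.irrefl h]⟩

theorem StepIn.symm {V : Type*} {G : SimpleGraph V} {B : Set V} {x y : V} (h : G.StepIn B x y) :
    G.StepIn B y x := ⟨h.1.symm, h.2.2, h.2.1⟩

theorem reflTransGen_stepIn_symm {V : Type*} {G : SimpleGraph V} {B : Set V} {x y : V}
    (h : Relation.ReflTransGen (G.StepIn B) x y) : Relation.ReflTransGen (G.StepIn B) y x := by
  induction h with
  | refl => exact .refl
  | tail _ h ih => exact .head h.symm ih

/-- A connected component of `B` is connected. -/
theorem reflTransGen_stepIn_component {V : Type*} {G : SimpleGraph V} {B : Set V} {n u v : V}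
    (hu : Relation.ReflTransGen (G.StepIn B) n u) (hv : Relation.ReflTransGen (G.StepIn B) n v) :
    Relation.ReflTransGen (G.StepIn {w | Relation.ReflTransGen (G.StepIn B) n w}) u v := by
  have key : ∀ w, Relation.ReflTransGen (G.StepIn B) n w →
      Relation.ReflTransGen (G.StepIn {w | Relation.ReflTransGen (G.StepIn B) n w}) n w := by
    intro w hw
    induction hw with
    | refl => exact .refl
    | tail h h' ih => exact .tail ih ⟨h'.1, h, h.tail h'⟩
  exact (reflTransGen_stepIn_symm (key u hu)).trans (key v hv)

theorem mem_of_reflTransGen_stepIn {V : Type*} {G : SimpleGraph V} {B : Set V} {n u : V}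
    (hn : n ∈ B) (h : Relation.ReflTransGen (G.StepIn B) n u) : u ∈ B := by
  induction h with
  | refl => exact hn
  | tail _ h _ => exact h.2.2

/-- A walk in `addApex T N` avoids the apex or starts with a walk in `T` that ends in `N`. -/
theorem reflTransGen_stepIn_addApex {U : Type*} {T : SimpleGraph U} {N : Set U}
    {B : Set (Option U)} {u : U} {b : Option U}
    (h : Relation.ReflTransGen ((addApex T N).StepIn B) (some u) b) :
    (∃ v, b = some v ∧ Relation.ReflTransGen (T.StepIn (some ⁻¹' B)) u v) ∨
      (none ∈ B ∧ ∃ n ∈ N, some n ∈ B ∧ Relation.ReflTransGen (T.StepIn (some ⁻¹' B)) u n) := by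
  induction h with
  | refl => exact .inl ⟨u, rfl, .refl⟩
  | @tail b c _ hbc ih =>
    rcases ih with ⟨v, rfl, hv⟩ | ih
    · rcases c with - | c
      · exact .inr ⟨hbc.2.2, v, hbc.1, hbc.2.1, hv⟩
      · exact .inl ⟨c, rfl, hv.tail hbc⟩
    · exact .inr ih

theorem exists_three_of_card {α : Type*} (s : Finset α) (h : 3 ≤ s.card) :
    ∃ σ : Fin 3 → α, Function.Injective σ ∧ ∀ j, σ j ∈ s := by
  obtain ⟨σ⟩ := Function.Embedding.nonempty_of_card_le (α := Fin 3) (β := s) (by simpa using h)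
  exact ⟨fun j => σ j, fun i j hij => σ.injective (Subtype.ext hij), fun j => (σ j).2⟩

theorem not_isMinor_addApex {U : Type*} [Fintype U] {T : SimpleGraph U}
    (hT : T.HasFaceLabellings (Fin 2 → Fin 2 → ZMod 2)) (N : Finset U) {t : ℕ}
    (ht : 4 ≤ t) (hN : 2 * N.card < t) :
    ¬ (completeBipartiteGraph (Fin 3) (Fin t)).IsMinor (addApex T (N : Set U)) := by
  classical
  rintro ⟨B, conn, disj, adj⟩
  have eqB : ∀ w w' x, x ∈ B w → x ∈ B w' → w = w' := fun w w' x hw hw' => by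
    by_contra hne
    exact Set.disjoint_left.1 (disj hne) hw hw'
  have conn' : ∀ w, none ∉ B w → ∀ u ∈ some ⁻¹' B w, ∀ v ∈ some ⁻¹' B w,
      Relation.ReflTransGen (T.StepIn (some ⁻¹' B w)) u v := by
    intro w hw u hu v hv
    rcases reflTransGen_stepIn_addApex (reflTransGen_stepIn_of_connected (conn w) hu hv) with
      ⟨v', h, hv'⟩ | h
    · rwa [Option.some_injective _ h]
    · exact (hw h.1).elim
  have adj' : ∀ i j, ∃ x ∈ B (.inl i), ∃ y ∈ B (.inr j), (addApex T (N : Set U)).Adj x y :=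
    fun i j => adj _ _ (by simp)
  have adjT : ∀ i j, none ∉ B (.inl i) → none ∉ B (.inr j) →
      ∃ a ∈ some ⁻¹' B (.inl i), ∃ b ∈ some ⁻¹' B (.inr j), T.Adj a b := by
    intro i j hi hj
    obtain ⟨x, hx, y, hy, hxy⟩ := adj' i j
    rcases x with - | x
    · exact (hi hx).elim
    rcases y with - | y
    · exact (hj hy).elim
    exact ⟨x, hx, y, hy, hxy⟩
  by_cases h0 : ∃ i, none ∈ B (.inl i)
  · obtain ⟨i₀, h0⟩ := h0
    have hr : ∀ j, none ∉ B (.inr j) := fun j h => Sum.inl_ne_inr (eqB _ _ _ h0 h)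
    have hl : ∀ i, i ≠ i₀ → none ∉ B (.inl i) := fun i hi h =>
      hi (Sum.inl_injective (eqB _ _ _ h h0))
    -- Charge each right branch set to a neighbour n of the apex: one it contains, or one in the
    -- component of `B (.inl i₀)` minus the apex to which it is adjacent.
    have hf : ∀ j, ∃ n ∈ N, some n ∈ B (.inr j) ∨ (some n ∈ B (.inl i₀) ∧
        ∃ a ∈ {w | Relation.ReflTransGen (T.StepIn (some ⁻¹' B (.inl i₀))) n w},
        ∃ b ∈ some ⁻¹' B (.inr j), T.Adj a b) := by
      intro j
      obtain ⟨x, hx, y, hy, hxy⟩ := adj' i₀ j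
      rcases y with - | y
      · exact (hr j hy).elim
      rcases x with - | x
      · exact ⟨y, hxy, .inl hy⟩
      · rcases reflTransGen_stepIn_addApex (reflTransGen_stepIn_of_connected (conn _) hx h0) with
          ⟨v, h, -⟩ | ⟨-, n, hn, hnB, hxn⟩
        · cases h
        · exact ⟨n, hn, .inr ⟨hnB, x, reflTransGen_stepIn_symm hxn, y, hy, hxy⟩⟩
    choose f hfN hf using hf
    obtain ⟨n, -, hn⟩ := Finset.exists_lt_card_fiber_of_mul_lt_card_of_maps_to (s := Finset.univ)
      (t := N) (f := f) (n := 2) (fun j _ => hfN j) (by simpa [mul_comm] using hN)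
    obtain ⟨σ, hσ, hσn⟩ := exists_three_of_card _ hn
    have hσn' : ∀ j, f (σ j) = n := fun j => (Finset.mem_filter.1 (hσn j)).2
    -- If n lay in one of the three sets, disjointness would forbid the charge from another of them.
    have hs : ∀ j, some n ∉ B (.inr (σ j)) := by
      intro j h
      have hne : σ (j + 1) ≠ σ j := fun e => by simpa using hσ e
      rcases hf (σ (j + 1)) with h' | ⟨h', -⟩ <;> rw [hσn'] at h'
      · exact hne (Sum.inr_injective (eqB _ _ _ h' h))
      · exact Sum.inl_ne_inr (eqB _ _ _ h' h)
    have hnB : some n ∈ B (.inl i₀) := by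
      rcases hf (σ 0) with h' | ⟨h', -⟩ <;> rw [hσn'] at h'
      · exact (hs 0 h').elim
      · exact h'
    let A : Fin 3 → Set U := fun i => if i = i₀ then
      {w | Relation.ReflTransGen (T.StepIn (some ⁻¹' B (.inl i₀))) n w} else some ⁻¹' B (.inl i)
    have hA : ∀ i v, v ∈ A i → some v ∈ B (.inl i) := by
      intro i v hv
      by_cases hi : i = i₀
      · simp only [A, if_pos hi] at hv
        rw [hi]
        exact mem_of_reflTransGen_stepIn (B := some ⁻¹' B (.inl i₀)) hnB hv
      · simp only [A, if_neg hi] at hv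
        exact hv
    refine hT.not_K33 A (fun j => some ⁻¹' B (.inr (σ j))) (fun i => ?_)
      (fun j => conn' _ (hr _)) (fun i i' v h h' => Sum.inl_injective (eqB _ _ _ (hA _ _ h) (hA _ _ h')))
      (fun j j' v h h' => hσ (Sum.inr_injective (eqB _ _ _ h h')))
      (fun i j v h h' => Sum.inl_ne_inr (eqB _ _ _ (hA _ _ h) h')) fun i j => ?_
    · by_cases hi : i = i₀
      · simp only [A, if_pos hi]
        exact fun u hu v hv => reflTransGen_stepIn_component hu hv
      · simp only [A, if_neg hi]
        exact conn' _ (hl i hi)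
    · by_cases hi : i = i₀
      · simp only [A, if_pos hi]
        have := (hf (σ j)).resolve_left (by rw [hσn']; exact hs j)
        rw [hσn'] at this
        exact this.2
      · simp only [A, if_neg hi]
        exact adjT _ _ (hl i hi) (hr _)
  · push Not at h0
    -- At most one right branch set contains the apex, so 4 ≤ t leaves three that avoid it.
    have hbad : (Finset.univ.filter fun j : Fin t => none ∈ B (.inr j)).card ≤ 1 := by
      rw [Finset.card_le_one]
      intro j hj j' hj'
      exact Sum.inr_injective (eqB _ _ _ (Finset.mem_filter.1 hj).2 (Finset.mem_filter.1 hj').2)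
    have hsum := Finset.card_filter_add_card_filter_not (s := (Finset.univ : Finset (Fin t)))
      fun j => none ∈ B (.inr j)
    rw [Finset.card_univ, Fintype.card_fin] at hsum
    obtain ⟨σ, hσ, hσB⟩ := exists_three_of_card
      (Finset.univ.filter fun j : Fin t => ¬ none ∈ B (.inr j)) (by omega)
    have hσB' : ∀ j, none ∉ B (.inr (σ j)) := fun j => (Finset.mem_filter.1 (hσB j)).2
    exact hT.not_K33 (fun i => some ⁻¹' B (.inl i)) (fun j => some ⁻¹' B (.inr (σ j)))
      (fun i => conn' _ (h0 i)) (fun j => conn' _ (hσB' j))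
      (fun i i' v h h' => Sum.inl_injective (eqB _ _ _ h h'))
      (fun j j' v h h' => hσ (Sum.inr_injective (eqB _ _ _ h h')))
      (fun i j v h h' => Sum.inl_ne_inr (eqB _ _ _ h h')) fun i j => adjT _ _ (h0 i) (hσB' j)

end SimpleGraph

/-! ### Reading off points of a handle surface on the sphere -/

namespace Surface

variable (S : Surface)

open Classical in
/-- The map of the sphere that moves the second circle of each handle to the first one. -/
noncomputable def fold (x : OnePoint ℂ) : OnePoint ℂ :=
  if h : ∃ (i : Fin S.handles) (z : ℂ), ‖z‖ = 1 ∧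
      x = ((S.center (.inl (i, true)) + S.radius (.inl (i, true)) * z : ℂ) : OnePoint ℂ) then
    ((S.center (.inl (h.choose, false)) + S.radius (.inl (h.choose, false)) *
      (starRingEnd ℂ) h.choose_spec.choose : ℂ) : OnePoint ℂ)
  else x

theorem mem_closedBall_of_norm_eq_one (i) {z : ℂ} (hz : ‖z‖ = 1) :
    S.center i + S.radius i * z ∈ Metric.closedBall (S.center i) (S.radius i) := by
  rw [Metric.mem_closedBall, dist_eq_norm, add_sub_cancel_left, norm_mul, hz, mul_one,
    Complex.norm_real, Real.norm_of_nonneg (S.radius_pos i).le]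

theorem index_eq {i j} {p : ℂ} (hi : p ∈ Metric.closedBall (S.center i) (S.radius i))
    (hj : p ∈ Metric.closedBall (S.center j) (S.radius j)) : i = j := by
  by_contra h
  exact Set.disjoint_left.1 (S.disjoint_discs h) hi hj

theorem fold_circle (i : Fin S.handles) {z : ℂ} (hz : ‖z‖ = 1) :
    S.fold ((S.center (.inl (i, true)) + S.radius (.inl (i, true)) * z : ℂ) : OnePoint ℂ) =
      ((S.center (.inl (i, false)) + S.radius (.inl (i, false)) * (starRingEnd ℂ) z : ℂ) :
        OnePoint ℂ) := by
  have h : ∃ (j : Fin S.handles) (w : ℂ), ‖w‖ = 1 ∧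
      ((S.center (.inl (i, true)) + S.radius (.inl (i, true)) * z : ℂ) : OnePoint ℂ) =
      ((S.center (.inl (j, true)) + S.radius (.inl (j, true)) * w : ℂ) : OnePoint ℂ) :=
    ⟨i, z, hz, rfl⟩
  rw [fold, dif_pos h]
  obtain ⟨hw, he⟩ := h.choose_spec.choose_spec
  generalize h.choose_spec.choose = w at *
  generalize h.choose = j at *
  rw [OnePoint.coe_eq_coe] at he ⊢
  have hij : i = j := by
    have := S.index_eq (S.mem_closedBall_of_norm_eq_one (.inl (i, true)) hz)
      (he ▸ S.mem_closedBall_of_norm_eq_one (.inl (j, true)) hw)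
    exact (Prod.mk.inj (Sum.inl_injective this)).1
  subst hij
  have hr : (S.radius (.inl (i, true)) : ℂ) ≠ 0 := by
    exact_mod_cast (S.radius_pos _).ne'
  rw [mul_left_cancel₀ hr (add_left_cancel he)]

theorem fold_eq_self {p : ℂ}
    (h : ∀ i : Fin S.handles, p ∉ Metric.closedBall (S.center (.inl (i, true)))
      (S.radius (.inl (i, true)))) : S.fold (p : OnePoint ℂ) = p := by
  rw [fold, dif_neg]
  rintro ⟨i, z, hz, he⟩
  rw [OnePoint.coe_eq_coe] at he
  exact h i (he ▸ S.mem_closedBall_of_norm_eq_one _ hz)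

/-- `fold` respects the identifications of a surface without crosscaps. -/
noncomputable def foldSpace (hS : S.crosscaps = 0) : S.Space → OnePoint ℂ :=
  Quot.lift (fun x => S.fold x.1) fun x y hxy => by
    cases hxy with
    | handle i z hz x y hx hy =>
      rw [hx, hy, S.fold_circle i (by simpa using hz), Complex.conj_conj, fold_eq_self]
      intro j hj
      have := S.index_eq hj (S.mem_closedBall_of_norm_eq_one _ hz)
      simp at this
    | crosscap j => exact (Fin.cast hS j).elim0

/-- A point of the plane outside the open discs, as a point of the surface. -/
def toSpace (p : ℂ) (hp : ∀ i, p ∉ Metric.ball (S.center i) (S.radius i)) : S.Space :=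
  Quot.mk _ ⟨p, fun i _ hw h => hp i (OnePoint.coe_injective h ▸ hw)⟩

theorem toSpace_circle (i : Fin S.handles) {z : ℂ} (hz : ‖z‖ = 1) (hp hq) :
    S.toSpace (S.center (.inl (i, false)) + S.radius (.inl (i, false)) * z) hp =
      S.toSpace (S.center (.inl (i, true)) + S.radius (.inl (i, true)) * (starRingEnd ℂ) z) hq :=
  Quot.sound (.handle i z hz _ _ rfl rfl)

/-- A segment of the plane that avoids the open discs, as a path in the surface. -/
def segmentPath (a b : ℂ) (h : ∀ t : unitInterval, ∀ i,
    a + (t : ℝ) * (b - a) ∉ Metric.ball (S.center i) (S.radius i)) :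
    Path (S.toSpace a (by simpa using h 0)) (S.toSpace b (by simpa using h 1)) where
  toFun t := S.toSpace (a + (t : ℝ) * (b - a)) (h t)
  continuous_toFun := by
    refine continuous_quot_mk.comp (Continuous.subtype_mk ?_ _)
    refine OnePoint.continuous_coe.comp ?_
    fun_prop
  source' := by simp
  target' := by simp

end Surface

/-! ### A concrete surface and the curves drawn on it -/

/-- `p` has integer part `u` and fractional part `(α, β)`. -/
def HasCell (p : ℂ) (u : ℕ × ℕ) (α β : ℝ) : Prop :=
  (p.re = u.1 + α ∧ p.im = u.2 + β) ∧ (0 ≤ α ∧ α < 1) ∧ (0 ≤ β ∧ β < 1)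

theorem natCast_add_eq {x x' : ℕ} {α α' : ℝ} (h0 : 0 ≤ α) (h1 : α < 1) (h0' : 0 ≤ α')
    (h1' : α' < 1) (h : (x : ℝ) + α = x' + α') : x = x' ∧ α = α' := by
  have e : x = x' := by
    have a : (x : ℝ) < x' + 1 := by linarith
    have b : (x' : ℝ) < x + 1 := by linarith
    have a' : x < x' + 1 := by exact_mod_cast a
    have b' : x' < x + 1 := by exact_mod_cast b
    omega
  subst e
  exact ⟨rfl, by linarith⟩

theorem HasCell.unique {p : ℂ} {u u' : ℕ × ℕ} {α β α' β' : ℝ} (h : HasCell p u α β)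
    (h' : HasCell p u' α' β') : u = u' ∧ α = α' ∧ β = β' := by
  obtain ⟨⟨e1, e2⟩, ⟨a0, a1⟩, b0, b1⟩ := h
  obtain ⟨⟨e1', e2'⟩, ⟨a0', a1'⟩, b0', b1'⟩ := h'
  obtain ⟨x, rfl⟩ := natCast_add_eq a0 a1 a0' a1' (e1.symm.trans e1')
  obtain ⟨y, rfl⟩ := natCast_add_eq b0 b1 b0' b1' (e2.symm.trans e2')
  exact ⟨Prod.ext x y, rfl, rfl⟩

/-- The surface with a handle for each `i : Fin k`, leading from a disc next to the lattice point
`c i` to a disc on the line `re = -1`. -/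
noncomputable def handleSurface {k : ℕ} (c : Fin k → ℕ × ℕ) (hc : Function.Injective c) :
    Surface where
  handles := k
  crosscaps := 0
  -- The open square of half-width 1/8 about (1/2, 1/4) misses the sides and both diagonals of the
  -- unit cell, so the disc fits whichever diagonal is present.
  center := Sum.elim (fun i => if i.2 then ⟨-1, (i.1 : ℕ)⟩
    else ⟨(c i.1).1 + 1 / 2, (c i.1).2 + 1 / 4⟩) Fin.elim0
  radius := fun _ => 1 / 8
  radius_pos := fun _ => by norm_num
  disjoint_discs := by
    have nat : ∀ a b : ℕ, a ≠ b → 1 ≤ |(a : ℝ) - b| := by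
      intro a b h
      have : (1 : ℤ) ≤ |(a : ℤ) - b| := Int.one_le_abs (sub_ne_zero.2 (by exact_mod_cast h))
      exact_mod_cast this
    intro i j hij
    apply Metric.closedBall_disjoint_closedBall
    rw [dist_eq_norm]
    have far : ∀ z : ℂ, (1 ≤ |z.re| ∨ 1 ≤ |z.im|) → (1 / 8 + 1 / 8 : ℝ) < ‖z‖ := by
      rintro z (h | h)
      · linarith [Complex.abs_re_le_norm z]
      · linarith [Complex.abs_im_le_norm z]
    apply far
    rcases i with ⟨i, b⟩ | i
    swap
    · exact i.elim0
    rcases j with ⟨j, b'⟩ | j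
    swap
    · exact j.elim0
    have fst : ∀ a : ℕ, 1 ≤ |(-1 : ℝ) - (a + 1 / 2)| := fun a => by
      rw [abs_sub_comm]
      exact le_trans (by linarith [(Nat.cast_nonneg a : (0 : ℝ) ≤ a)]) (le_abs_self _)
    cases b <;> cases b'
    · have hne : c i ≠ c j := fun h => hij (by rw [hc h])
      by_cases h1 : (c i).1 = (c j).1
      · right
        have := nat _ _ fun h2 => hne (Prod.ext h1 h2)
        simpa using this
      · left
        simpa using nat _ _ h1
    · left
      have := fst (c i).1
      rw [abs_sub_comm] at this
      simpa using this
    · left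
      simpa using fst (c j).1
    · right
      have hne : (i : ℕ) ≠ j := fun h => hij (by rw [Fin.ext h])
      simpa using nat _ _ hne

section

variable {k : ℕ} (c : Fin k → ℕ × ℕ) (hc : Function.Injective c)

theorem avoids_iff {p : ℂ} : (∀ i, p ∉ Metric.ball ((handleSurface c hc).center i)
    ((handleSurface c hc).radius i)) ↔ ∀ i : Fin k,
      p ∉ Metric.ball ⟨(c i).1 + 1 / 2, (c i).2 + 1 / 4⟩ (1 / 8) ∧
      p ∉ Metric.ball ⟨-1, (i : ℕ)⟩ (1 / 8) := by
  refine ⟨fun h i => ⟨h (.inl (i, false)), h (.inl (i, true))⟩, fun h i => ?_⟩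
  rcases i with ⟨i, b⟩ | i
  · cases b
    · exact (h i).1
    · exact (h i).2
  · exact i.elim0

theorem abs_re_im_lt_of_mem_ball {p q : ℂ} {r : ℝ} (h : p ∈ Metric.ball q r) :
    |p.re - q.re| < r ∧ |p.im - q.im| < r := by
  rw [Metric.mem_ball, dist_eq_norm] at h
  exact ⟨(Complex.abs_re_le_norm (p - q)).trans_lt h, (Complex.abs_im_le_norm (p - q)).trans_lt h⟩

theorem HasCell.avoids {p : ℂ} {u : ℕ × ℕ} {α β : ℝ} (h : HasCell p u α β)
    (hb : α ≤ 3 / 8 ∨ 5 / 8 ≤ α ∨ β ≤ 1 / 8 ∨ 3 / 8 ≤ β) : ∀ i,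
    p ∉ Metric.ball ((handleSurface c hc).center i) ((handleSurface c hc).radius i) := by
  rw [avoids_iff]
  refine fun i => ⟨fun hp => ?_, fun hp => ?_⟩
  · obtain ⟨h1, h2⟩ := abs_re_im_lt_of_mem_ball hp
    simp only [abs_lt] at h1 h2
    obtain ⟨-, e1, e2⟩ := h.unique (u' := c i) (α' := p.re - (c i).1) (β' := p.im - (c i).2)
      ⟨⟨by ring, by ring⟩, ⟨by linarith, by linarith⟩, by linarith, by linarith⟩
    rw [e1, e2] at hb
    rcases hb with hb | hb | hb | hb <;> linarith
  · obtain ⟨h1, h2⟩ := abs_re_im_lt_of_mem_ball hp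
    simp only [abs_lt] at h1 h2
    linarith [h.1.1, h.2.1.1, (Nat.cast_nonneg u.1 : (0 : ℝ) ≤ u.1)]

theorem avoids_of_re_le {p : ℂ} (h : p.re ≤ -9 / 8) : ∀ i,
    p ∉ Metric.ball ((handleSurface c hc).center i) ((handleSurface c hc).radius i) := by
  rw [avoids_iff]
  refine fun i => ⟨fun hp => ?_, fun hp => ?_⟩
  · obtain ⟨h1, h2⟩ := abs_re_im_lt_of_mem_ball hp
    simp only [abs_lt] at h1 h2
    linarith [(Nat.cast_nonneg (c i).1 : (0 : ℝ) ≤ (c i).1)]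
  · obtain ⟨h1, h2⟩ := abs_re_im_lt_of_mem_ball hp
    simp only [abs_lt] at h1 h2
    linarith

theorem fold_eq_self_of_re {p : ℂ} (h : p.re < -9 / 8 ∨ 0 ≤ p.re) :
    (handleSurface c hc).fold (p : OnePoint ℂ) = p := by
  refine Surface.fold_eq_self _ fun i hp => ?_
  change p ∈ Metric.closedBall (⟨-1, (i.val : ℕ)⟩ : ℂ) (1 / 8) at hp
  rw [Metric.mem_closedBall, dist_eq_norm] at hp
  have := (Complex.abs_re_le_norm _).trans hp
  rw [Complex.sub_re, abs_le] at this
  dsimp only at this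
  rcases h with h | h <;> linarith

theorem HasCell.fold_eq_self {p : ℂ} {u : ℕ × ℕ} {α β : ℝ} (h : HasCell p u α β) :
    (handleSurface c hc).fold (p : OnePoint ℂ) = p :=
  fold_eq_self_of_re c hc (.inr (by
    rw [h.1.1]
    exact add_nonneg (Nat.cast_nonneg _) h.2.1.1))

end

/-- `p` is an inner point of the segment that draws the step from `u` to `v`. -/
def LatticeInterior (d : ℕ → ℕ → Prop) (u v : ℕ × ℕ) (p : ℂ) : Prop :=
  ∃ w α β, HasCell p w α β ∧
    ((0 < α ∧ β = 0 ∧ u = w ∧ v = (w.1 + 1, w.2)) ∨ (α = 0 ∧ 0 < β ∧ u = w ∧ v = (w.1, w.2 + 1)) ∨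
    (0 < α ∧ α = β ∧ u = w ∧ v = (w.1 + 1, w.2 + 1) ∧ d (w.1 + 1) (w.2 + 1)) ∨
    (0 < α ∧ α + β = 1 ∧ u = (w.1, w.2 + 1) ∧ v = (w.1 + 1, w.2) ∧ ¬ d (w.1 + 1) (w.2 + 1)))

/-- Half-open cells give every point unique coordinates, and within a cell the four kinds of segment
are disjoint, as only one of the two diagonals is present. -/
theorem LatticeInterior.unique {d : ℕ → ℕ → Prop} {u v u' v' : ℕ × ℕ} {p : ℂ}
    (h : LatticeInterior d u v p) (h' : LatticeInterior d u' v' p) : u = u' ∧ v = v' := by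
  obtain ⟨w, α, β, hw, h⟩ := h
  obtain ⟨w', α', β', hw', h'⟩ := h'
  obtain ⟨rfl, rfl, rfl⟩ := hw.unique hw'
  have h0 := hw.2
  rcases h with ⟨h1, h2, rfl, rfl⟩ | ⟨h1, h2, rfl, rfl⟩ | ⟨h1, h2, rfl, rfl, hd⟩ |
    ⟨h1, h2, rfl, rfl, hd⟩ <;>
  rcases h' with ⟨h1', h2', rfl, rfl⟩ | ⟨h1', h2', rfl, rfl⟩ | ⟨h1', h2', rfl, rfl, hd'⟩ |
    ⟨h1', h2', rfl, rfl, hd'⟩ <;>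
  first
  | exact ⟨rfl, rfl⟩
  | exact absurd hd hd'
  | exact absurd hd' hd
  | (exfalso; linarith)

theorem LatticeInterior.not_vertex {d : ℕ → ℕ → Prop} {u v w : ℕ × ℕ} {p : ℂ}
    (h : LatticeInterior d u v p) (hp : HasCell p w 0 0) : False := by
  obtain ⟨w, α, β, hw, h⟩ := h
  obtain ⟨rfl, rfl, rfl⟩ := hw.unique hp
  rcases h with h | h | h | h
  exacts [h.1.false, h.2.1.false, h.1.false, h.1.false]

theorem LatticeInterior.avoids {d : ℕ → ℕ → Prop} {u v : ℕ × ℕ} {p : ℂ} {k : ℕ}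
    (c : Fin k → ℕ × ℕ) (hc : Function.Injective c) (h : LatticeInterior d u v p) : ∀ i,
    p ∉ Metric.ball ((handleSurface c hc).center i) ((handleSurface c hc).radius i) := by
  obtain ⟨w, α, β, hw, h⟩ := h
  refine hw.avoids c hc ?_
  rcases h with h | h | h | h
  · exact .inr (.inr (.inl (by linarith [h.2.1])))
  · exact .inl (by linarith [h.1])
  · by_contra! hn
    linarith [h.2.1]
  · by_contra! hn
    linarith [h.2.1]

/-- The position of a lattice point in the plane. -/
def latticePoint (u : ℕ × ℕ) : ℂ := ⟨u.1, u.2⟩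

theorem hasCell_latticePoint (u : ℕ × ℕ) : HasCell (latticePoint u) u 0 0 :=
  ⟨⟨(add_zero _).symm, (add_zero _).symm⟩, by norm_num, by norm_num⟩

theorem re_segment (a b : ℂ) (t : ℝ) : (a + t * (b - a)).re = a.re + t * (b.re - a.re) := by simp

theorem im_segment (a b : ℂ) (t : ℝ) : (a + t * (b - a)).im = a.im + t * (b.im - a.im) := by simp

theorem latticeInterior_segment {d : ℕ → ℕ → Prop} {u v : ℕ × ℕ} (h : LatticeStep d u v) {t : ℝ}
    (h0 : 0 < t) (h1 : t < 1) :
    LatticeInterior d u v (latticePoint u + t * (latticePoint v - latticePoint u)) := by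
  obtain ⟨x, y⟩ := u
  obtain ⟨x', y'⟩ := v
  simp only [LatticeStep] at h
  rcases h with ⟨rfl, rfl⟩ | ⟨rfl, rfl⟩ | ⟨rfl, rfl, hd⟩ | ⟨rfl, rfl, hd⟩
  · refine ⟨(x, y'), t, 0, ⟨⟨?_, ?_⟩, ⟨h0.le, h1⟩, le_rfl, one_pos⟩, .inl ⟨h0, rfl, rfl, rfl⟩⟩
    · rw [re_segment]; simp [latticePoint]
    · rw [im_segment]; simp [latticePoint]
  · refine ⟨(x', y), 0, t, ⟨⟨?_, ?_⟩, ⟨le_rfl, one_pos⟩, h0.le, h1⟩, .inr (.inl ⟨rfl, h0, rfl, rfl⟩)⟩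
    · rw [re_segment]; simp [latticePoint]
    · rw [im_segment]; simp [latticePoint]
  · refine ⟨(x, y), t, t, ⟨⟨?_, ?_⟩, ⟨h0.le, h1⟩, h0.le, h1⟩,
      .inr (.inr (.inl ⟨h0, rfl, rfl, rfl, hd⟩))⟩
    · rw [re_segment]; simp [latticePoint]
    · rw [im_segment]; simp [latticePoint]
  · refine ⟨(x, y'), t, 1 - t, ⟨⟨?_, ?_⟩, ⟨h0.le, h1⟩, by linarith, by linarith⟩,
      .inr (.inr (.inr ⟨h0, by ring, rfl, rfl, hd⟩))⟩
    · rw [re_segment]; simp [latticePoint]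
    · rw [im_segment]; simp [latticePoint]; ring

section

variable {k : ℕ} (c : Fin k → ℕ × ℕ) (hc : Function.Injective c)

/-- `p` is an inner point of the drawing of the edge from the apex to `c i`. -/
def ApexInterior (i : Fin k) (p : ℂ) : Prop :=
  (∃ α β, HasCell p (c i) α β ∧ 0 < α ∧ α ≤ 3 / 8 ∧ 3 * β = 2 * α) ∨
    (p.re < -9 / 8 ∧ -2 < p.re ∧ p.im = i * ((p.re + 2) * (8 / 7)))

variable {c} in
include hc in
theorem ApexInterior.unique {i j : Fin k} {p : ℂ} (h : ApexInterior c i p)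
    (h' : ApexInterior c j p) : i = j := by
  rcases h with ⟨α, β, h, -⟩ | h <;> rcases h' with ⟨α', β', h', -⟩ | h'
  · exact hc (h.unique h').1
  · linarith [h.1.1, h.2.1.1, h'.1, (Nat.cast_nonneg (c i).1 : (0 : ℝ) ≤ (c i).1)]
  · linarith [h'.1.1, h'.2.1.1, h.1, (Nat.cast_nonneg (c j).1 : (0 : ℝ) ≤ (c j).1)]
  · have : ((i : ℕ) : ℝ) = (j : ℕ) :=
      mul_right_cancel₀ (by linarith [h.2.1] : (p.re + 2) * (8 / 7) ≠ 0) (h.2.2.symm.trans h'.2.2)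
    exact Fin.ext (by exact_mod_cast this)

variable {c}

theorem ApexInterior.not_lattice {i : Fin k} {p : ℂ} {d : ℕ → ℕ → Prop} {u v : ℕ × ℕ}
    (h : ApexInterior c i p) (h' : LatticeInterior d u v p) : False := by
  obtain ⟨w, α, β, hw, h'⟩ := h'
  rcases h with ⟨α, β, h, h0⟩ | h
  · obtain ⟨-, rfl, rfl⟩ := h.unique hw
    rcases h' with h' | h' | h' | h'
    · linarith [h'.2.1]
    · linarith [h'.1]
    · linarith [h'.2.1]
    · linarith [h'.2.1]
  · linarith [hw.1.1, hw.2.1.1, h.1, (Nat.cast_nonneg w.1 : (0 : ℝ) ≤ w.1)]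

theorem ApexInterior.not_vertex {i : Fin k} {p : ℂ} {w : ℕ × ℕ}
    (h : ApexInterior c i p) (hp : HasCell p w 0 0) : False := by
  rcases h with ⟨α, β, h, h0⟩ | h
  · obtain ⟨-, rfl, rfl⟩ := h.unique hp
    exact h0.1.false
  · linarith [hp.1.1, h.1, (Nat.cast_nonneg w.1 : (0 : ℝ) ≤ w.1)]

variable (c)

noncomputable def latticeVertex (u : ℕ × ℕ) : (handleSurface c hc).Space :=
  (handleSurface c hc).toSpace (latticePoint u)
    ((hasCell_latticePoint u).avoids c hc (.inl (by norm_num)))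

noncomputable def apexVertex : (handleSurface c hc).Space :=
  (handleSurface c hc).toSpace ⟨-2, 0⟩ (avoids_of_re_le c hc (by norm_num))

theorem exists_lattice_path {d : ℕ → ℕ → Prop} {u v : ℕ × ℕ} (h : LatticeStep d u v) :
    ∃ γ : Path (latticeVertex c hc u) (latticeVertex c hc v), Function.Injective γ ∧
      ∀ t ∈ Set.Ioo (0 : unitInterval) 1, ∃ p : ℂ,
        (handleSurface c hc).foldSpace rfl (γ t) = p ∧ LatticeInterior d u v p := by
  have hint : ∀ t ∈ Set.Ioo (0 : unitInterval) 1,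
      LatticeInterior d u v (latticePoint u + (t : ℝ) * (latticePoint v - latticePoint u)) :=
    fun t ht => latticeInterior_segment h ht.1 ht.2
  have hav : ∀ t : unitInterval, (∀ i, latticePoint u + (t : ℝ) * (latticePoint v - latticePoint u) ∉
      Metric.ball ((handleSurface c hc).center i) ((handleSurface c hc).radius i)) ∧
      (handleSurface c hc).fold
        ((latticePoint u + (t : ℝ) * (latticePoint v - latticePoint u) : ℂ) : OnePoint ℂ) =
        ((latticePoint u + (t : ℝ) * (latticePoint v - latticePoint u) : ℂ) : OnePoint ℂ) := by
    intro t
    rcases eq_or_lt_of_le t.2.1 with h0 | h0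
    · rw [← h0, Complex.ofReal_zero, zero_mul, add_zero]
      exact ⟨(hasCell_latticePoint u).avoids c hc (.inl (by norm_num)),
        (hasCell_latticePoint u).fold_eq_self c hc⟩
    rcases eq_or_lt_of_le t.2.2 with h1 | h1
    · rw [h1, Complex.ofReal_one, one_mul, add_sub_cancel]
      exact ⟨(hasCell_latticePoint v).avoids c hc (.inl (by norm_num)),
        (hasCell_latticePoint v).fold_eq_self c hc⟩
    · have := hint t ⟨h0, h1⟩
      refine ⟨this.avoids c hc, ?_⟩
      obtain ⟨_, _, _, hw, -⟩ := this
      exact hw.fold_eq_self c hc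
  have hfold : ∀ t : unitInterval, (handleSurface c hc).foldSpace rfl
      ((handleSurface c hc).segmentPath _ _ (fun t => (hav t).1) t) =
      ((latticePoint u + (t : ℝ) * (latticePoint v - latticePoint u) : ℂ) : OnePoint ℂ) :=
    fun t => (hav t).2
  refine ⟨(handleSurface c hc).segmentPath _ _ fun t => (hav t).1, fun s t hst => ?_,
    fun t ht => ⟨_, hfold t, hint t ht⟩⟩
  have he := congrArg ((handleSurface c hc).foldSpace rfl) hst
  replace he := OnePoint.coe_injective ((hfold s).symm.trans (he.trans (hfold t)))
  rw [add_right_inj] at he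
  have hne : latticePoint v - latticePoint u ≠ 0 := by
    intro h0
    have := hint ⟨1 / 2, by norm_num, by norm_num⟩
      ⟨Subtype.mk_lt_mk.2 (by norm_num), Subtype.mk_lt_mk.2 (by norm_num)⟩
    rw [h0, mul_zero, add_zero] at this
    exact this.not_vertex (hasCell_latticePoint u)
  exact Subtype.ext (by exact_mod_cast mul_right_cancel₀ hne he)

theorem toSpace_congr (S : Surface) {p q : ℂ} (h : p = q) (hp hq) :
    S.toSpace p hp = S.toSpace q hq := by
  subst h
  rfl

/-- The edge runs straight from (-2, 0) to the leftmost point of the i-th disc on re = -1, crosses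
the handle to the leftmost point of the disc beside `c i`, and goes straight to `c i`. This last
segment has slope 2/3 and α ≤ 3/8, so it meets no grid edge before its end. -/
theorem exists_apex_path (i : Fin k) :
    ∃ γ : Path (apexVertex c hc) (latticeVertex c hc (c i)), Function.Injective γ ∧
      ∀ t ∈ Set.Ioo (0 : unitInterval) 1, ∃ p : ℂ,
        (handleSurface c hc).foldSpace rfl (γ t) = p ∧ ApexInterior c i p := by
  let a : ℂ := ⟨-9 / 8, (i : ℕ)⟩
  let b : ℂ := ⟨(c i).1 + 3 / 8, (c i).2 + 1 / 4⟩
  have re₁ : ∀ t : ℝ, ((⟨-2, 0⟩ : ℂ) + t * (a - ⟨-2, 0⟩)).re = -2 + 7 / 8 * t := fun t => by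
    rw [re_segment]; dsimp only [a]; ring
  have im₁ : ∀ t : ℝ, ((⟨-2, 0⟩ : ℂ) + t * (a - ⟨-2, 0⟩)).im = i * t := fun t => by
    rw [im_segment]; dsimp only [a]; ring
  have re₂ : ∀ t : ℝ, (b + t * (latticePoint (c i) - b)).re = (c i).1 + 3 / 8 * (1 - t) := fun t => by
    rw [re_segment]; dsimp only [b, latticePoint]; ring
  have im₂ : ∀ t : ℝ, (b + t * (latticePoint (c i) - b)).im = (c i).2 + 1 / 4 * (1 - t) := fun t => by
    rw [im_segment]; dsimp only [b, latticePoint]; ring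
  have cell : ∀ t : ℝ, 0 ≤ t → t ≤ 1 →
      HasCell (b + t * (latticePoint (c i) - b)) (c i) (3 / 8 * (1 - t)) (1 / 4 * (1 - t)) :=
    fun t h0 h1 => ⟨⟨re₂ t, im₂ t⟩, ⟨by linarith, by linarith⟩, by linarith, by linarith⟩
  have av₁ : ∀ t : unitInterval, ∀ j, (⟨-2, 0⟩ : ℂ) + (t : ℝ) * (a - ⟨-2, 0⟩) ∉
      Metric.ball ((handleSurface c hc).center j) ((handleSurface c hc).radius j) :=
    fun t => avoids_of_re_le c hc (by rw [re₁]; linarith [t.2.2])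
  have av₂ : ∀ t : unitInterval, ∀ j, b + (t : ℝ) * (latticePoint (c i) - b) ∉
      Metric.ball ((handleSurface c hc).center j) ((handleSurface c hc).radius j) :=
    fun t => (cell t t.2.1 t.2.2).avoids c hc (.inl (by linarith [t.2.1]))
  let γ₁ := (handleSurface c hc).segmentPath _ _ av₁
  let γ₂ := (handleSurface c hc).segmentPath _ _ av₂
  -- Gluing conjugates the unit parameter, which fixes z = -1: leftmost point meets leftmost point.
  have glue : (handleSurface c hc).toSpace a (by simpa using av₁ 1) =
      (handleSurface c hc).toSpace b (by simpa using av₂ 0) := by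
    have ea : (handleSurface c hc).center (.inl (i, true)) +
        (handleSurface c hc).radius (.inl (i, true)) * (starRingEnd ℂ) (-1) = a := by
      apply Complex.ext <;> simp [handleSurface, a]
      norm_num
    have eb : (handleSurface c hc).center (.inl (i, false)) +
        (handleSurface c hc).radius (.inl (i, false)) * (-1) = b := by
      apply Complex.ext <;> simp [handleSurface, b]
      norm_num
      ring
    refine (toSpace_congr _ ea.symm _ (by rw [ea]; simpa using av₁ 1)).trans
      (((handleSurface c hc).toSpace_circle i (z := -1) (by simp)
        (by rw [eb]; simpa using av₂ 0) _).symm.trans (toSpace_congr _ eb _ _))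
  let γ := γ₁.trans (γ₂.cast glue rfl)
  -- Time 1/2 is excluded: `fold` moves the gluing point to the circle beside `c i`, so it belongs
  -- to the second half.
  have f₁ : ∀ t : unitInterval, (t : ℝ) < 1 / 2 → (handleSurface c hc).foldSpace rfl (γ t) =
      (((⟨-2, 0⟩ : ℂ) + (2 * t : ℝ) * (a - ⟨-2, 0⟩) : ℂ) : OnePoint ℂ) := by
    intro t ht
    simp only [γ, Path.trans_apply, dif_pos ht.le]
    exact fold_eq_self_of_re c hc (.inl (by rw [re₁]; linarith))
  have f₂ : ∀ t : unitInterval, 1 / 2 ≤ (t : ℝ) → (handleSurface c hc).foldSpace rfl (γ t) =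
      ((b + (2 * t - 1 : ℝ) * (latticePoint (c i) - b) : ℂ) : OnePoint ℂ) := by
    intro t ht
    have hfold := (cell (2 * t - 1) (by linarith) (by linarith [t.2.2])).fold_eq_self c hc
    rcases eq_or_lt_of_le ht with h | h
    · have h' : γ t = γ₂ 0 := by
        simp only [γ, Path.trans_apply, dif_pos h.ge]
        have e1 : ∀ h, (⟨2 * t, h⟩ : unitInterval) = 1 := fun _ => Subtype.ext (by
          change 2 * (t : ℝ) = 1
          linarith)
        rw [e1, γ₁.target, γ₂.source, glue]
      rw [h', ← hfold, ← h]
      have e0 : (2 * (1 / 2) - 1 : ℝ) = ((0 : unitInterval) : ℝ) := by norm_num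
      rw [e0]
      rfl
    · simp only [γ, Path.trans_apply, dif_neg h.not_ge]
      exact hfold
  refine ⟨γ, fun s t hst => ?_, fun t ht => ?_⟩
  · have he := congrArg ((handleSurface c hc).foldSpace rfl) hst
    have pos := (Nat.cast_nonneg (c i).1 : (0 : ℝ) ≤ (c i).1)
    rcases lt_or_ge (s : ℝ) (1 / 2) with hs | hs <;> rcases lt_or_ge (t : ℝ) (1 / 2) with ht | ht
    · have := congrArg Complex.re
        (OnePoint.coe_injective ((f₁ s hs).symm.trans (he.trans (f₁ t ht))))
      rw [re₁, re₁] at this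
      exact Subtype.ext (by linarith)
    · have := congrArg Complex.re
        (OnePoint.coe_injective ((f₁ s hs).symm.trans (he.trans (f₂ t ht))))
      rw [re₁, re₂] at this
      linarith [t.2.2]
    · have := congrArg Complex.re
        (OnePoint.coe_injective ((f₂ s hs).symm.trans (he.trans (f₁ t ht))))
      rw [re₁, re₂] at this
      linarith [s.2.2]
    · have := congrArg Complex.re
        (OnePoint.coe_injective ((f₂ s hs).symm.trans (he.trans (f₂ t ht))))
      rw [re₂, re₂] at this
      exact Subtype.ext (by linarith)
  · have h0 : 0 < (t : ℝ) := ht.1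
    have h1 : (t : ℝ) < 1 := ht.2
    rcases lt_or_ge (t : ℝ) (1 / 2) with h | h
    · refine ⟨_, f₁ t h, .inr ⟨?_, ?_, ?_⟩⟩
      · rw [re₁]; linarith
      · rw [re₁]; linarith
      · rw [re₁, im₁]; ring
    · exact ⟨_, f₂ t h, .inl ⟨_, _, cell _ (by linarith) (by linarith), by linarith, by linarith,
        by ring⟩⟩

end

/-! ### Drawing the apex graph -/

namespace SimpleGraph

/-- Points of the quotient are told apart by their images under `foldSpace`, so every disjointness
condition becomes a statement about coordinates in the plane. -/
theorem nonempty_drawing {k n : ℕ} (d : ℕ → ℕ → Prop) (c : Fin k → Fin n × Fin n)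
    (hc : Function.Injective fun i => ((c i).1.val, (c i).2.val)) :
    Nonempty ((addApex (triangulatedGrid d n) (Set.range c)).Drawing
      (handleSurface (fun i => ((c i).1.val, (c i).2.val)) hc).Space) := by
  classical
  let val : Fin n × Fin n → ℕ × ℕ := fun u => (u.1, u.2)
  have val_inj : Function.Injective val := by
    rintro ⟨a, b⟩ ⟨a', b'⟩ h
    simpa [val, Fin.ext_iff] using h
  let X := (handleSurface (fun i => val (c i)) hc).Space
  let fold : X → OnePoint ℂ := (handleSurface (fun i => val (c i)) hc).foldSpace rfl
  let point : Option (Fin n × Fin n) → X := fun x =>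
    x.elim (apexVertex _ hc) fun u => latticeVertex _ hc (val u)
  let Interior : Option (Fin n × Fin n) → Option (Fin n × Fin n) → ℂ → Prop := fun a b p =>
    (∃ u v, a = some u ∧ b = some v ∧ LatticeInterior d (val u) (val v) p) ∨
    (∃ i, a = none ∧ b = some (c i) ∧ ApexInterior (fun i => val (c i)) i p)
  have fold_some : ∀ u, fold (point (some u)) = (latticePoint (val u) : OnePoint ℂ) :=
    fun u => (hasCell_latticePoint (val u)).fold_eq_self _ hc
  have fold_none : fold (point none) = ((⟨-2, 0⟩ : ℂ) : OnePoint ℂ) :=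
    fold_eq_self_of_re _ hc (.inl (by norm_num))
  have interior_unique : ∀ a b a' b' p, Interior a b p → Interior a' b' p → a = a' ∧ b = b' := by
    rintro a b a' b' p (⟨u, v, rfl, rfl, h⟩ | ⟨i, rfl, rfl, h⟩)
      (⟨u', v', rfl, rfl, h'⟩ | ⟨i', rfl, rfl, h'⟩)
    · obtain ⟨e1, e2⟩ := h.unique h'
      rw [val_inj e1, val_inj e2]
      exact ⟨rfl, rfl⟩
    · exact (h'.not_lattice h).elim
    · exact (h.not_lattice h').elim
    · rw [h.unique hc h']
      exact ⟨rfl, rfl⟩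
  have interior_ne : ∀ a b p, Interior a b p → ∀ x, fold (point x) ≠ (p : OnePoint ℂ) := by
    intro a b p h x hx
    rcases x with - | w
    · rw [fold_none, OnePoint.coe_eq_coe] at hx
      subst hx
      rcases h with ⟨u, v, rfl, rfl, w, α, β, hw, -⟩ | ⟨i, rfl, rfl, ⟨α, β, hw, -⟩ | h⟩
      · have h1 := hw.1.1
        have h2 := hw.2.1.1
        dsimp only at h1
        linarith [(Nat.cast_nonneg w.1 : (0 : ℝ) ≤ w.1)]
      · have h1 := hw.1.1
        have h2 := hw.2.1.1
        dsimp only at h1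
        linarith [(Nat.cast_nonneg (val (c i)).1 : (0 : ℝ) ≤ (val (c i)).1)]
      · exact h.2.1.false
    · rw [fold_some, OnePoint.coe_eq_coe] at hx
      subst hx
      rcases h with ⟨u, v, rfl, rfl, h⟩ | ⟨i, rfl, rfl, h⟩
      · exact h.not_vertex (hasCell_latticePoint _)
      · exact h.not_vertex (hasCell_latticePoint _)
  have key : ∀ e : (addApex (triangulatedGrid d n) (Set.range c)).edgeSet,
      ∃ a b, (e : Sym2 _) = s(a, b) ∧ ∃ γ : _root_.Path (point a) (point b), Function.Injective γ ∧
        ∀ t ∈ Set.Ioo (0 : unitInterval) 1, ∃ p : ℂ, fold (γ t) = p ∧ Interior a b p := by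
    have lattice : ∀ u v, LatticeStep d (val u) (val v) → ∃ γ : _root_.Path (point (some u))
        (point (some v)), Function.Injective γ ∧ ∀ t ∈ Set.Ioo (0 : unitInterval) 1,
        ∃ p : ℂ, fold (γ t) = p ∧ Interior (some u) (some v) p := by
      intro u v h
      obtain ⟨γ, h1, h2⟩ := exists_lattice_path (fun i => val (c i)) hc h
      exact ⟨γ, h1, fun t ht => (h2 t ht).imp fun p hp => ⟨hp.1, .inl ⟨u, v, rfl, rfl, hp.2⟩⟩⟩
    have apex : ∀ i, ∃ γ : _root_.Path (point none) (point (some (c i))), Function.Injective γ ∧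
        ∀ t ∈ Set.Ioo (0 : unitInterval) 1,
        ∃ p : ℂ, fold (γ t) = p ∧ Interior none (some (c i)) p := by
      intro i
      obtain ⟨γ, h1, h2⟩ := exists_apex_path (fun i => val (c i)) hc i
      exact ⟨γ, h1, fun t ht => (h2 t ht).imp fun p hp => ⟨hp.1, .inr ⟨i, rfl, rfl, hp.2⟩⟩⟩
    rintro ⟨e, he⟩
    induction e with | _ a b
    rw [mem_edgeSet] at he
    rcases a with - | a <;> rcases b with - | b
    · exact he.elim
    · obtain ⟨i, rfl⟩ := he
      exact ⟨_, _, rfl, apex i⟩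
    · obtain ⟨i, rfl⟩ := he
      exact ⟨_, _, Sym2.eq_swap, apex i⟩
    · rcases he with he | he
      · exact ⟨_, _, rfl, lattice a b he⟩
      · exact ⟨_, _, Sym2.eq_swap, lattice b a he⟩
  choose a b hab γ γ_inj hγ using key
  refine ⟨{
    point := point
    arc := fun e => (γ e).toContinuousMap
    point_injective := fun x y hxy => ?_
    arc_injective := γ_inj
    arc_ends := fun e => ⟨a e, b e, hab e, (γ e).source, (γ e).target⟩
    arc_ne_point := fun e t ht x hx => ?_
    arc_ne_arc := fun e e' hne t ht t' ht' h => ?_ }⟩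
  · have h := congrArg fold hxy
    rcases x with - | u <;> rcases y with - | v
    · rfl
    · rw [fold_none, fold_some, OnePoint.coe_eq_coe] at h
      have := congrArg Complex.re h
      dsimp only [latticePoint] at this
      linarith [(Nat.cast_nonneg (val v).1 : (0 : ℝ) ≤ (val v).1)]
    · rw [fold_none, fold_some, OnePoint.coe_eq_coe] at h
      have := congrArg Complex.re h
      dsimp only [latticePoint] at this
      linarith [(Nat.cast_nonneg (val u).1 : (0 : ℝ) ≤ (val u).1)]
    · rw [fold_some, fold_some, OnePoint.coe_eq_coe] at h
      exact congrArg some (val_inj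
        ((hasCell_latticePoint (val u)).unique (h ▸ hasCell_latticePoint (val v))).1)
  · obtain ⟨p, hp, hint⟩ := hγ e t ht
    exact interior_ne _ _ _ hint x ((congrArg fold hx).symm.trans hp)
  · obtain ⟨p, hp, hint⟩ := hγ e t ht
    obtain ⟨p', hp', hint'⟩ := hγ e' t' ht'
    have e1 := OnePoint.coe_injective (hp.symm.trans ((congrArg fold h).trans hp'))
    subst e1
    obtain ⟨h1, h2⟩ := interior_unique _ _ _ _ _ hint hint'
    exact hne (Subtype.ext (by rw [hab e, hab e', h1, h2]))

theorem eulerGenus_addApex_le {k n : ℕ} (d : ℕ → ℕ → Prop) (c : Fin k → Fin n × Fin n)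
    (hc : Function.Injective c) :
    (addApex (triangulatedGrid d n) (Set.range c)).eulerGenus ≤ (2 * k : ℕ) := by
  have hc' : Function.Injective fun i => ((c i).1.val, (c i).2.val) := fun i j h => hc
    (Prod.ext (Fin.ext (congrArg Prod.fst h)) (Fin.ext (congrArg Prod.snd h)))
  exact iInf₂_le_of_le _ (nonempty_drawing d c hc') le_rfl

end SimpleGraph

/-! ### The block construction and its parameters -/

namespace SimpleGraph

/-- In blocks of side `2 * ρ + 1`, the diagonal of every cell points towards the centre of the
block of its lower left corner. -/
def BlockDiagonal (ρ : ℕ) (x y : ℕ) : Prop :=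
  (x - 1) % (2 * ρ + 1) < ρ ↔ (y - 1) % (2 * ρ + 1) < ρ

theorem blockDiagonal_succ {ρ p q : ℕ} (A B : ℕ) (hp : p < 2 * ρ + 1) (hq : q < 2 * ρ + 1) :
    BlockDiagonal ρ ((2 * ρ + 1) * A + p + 1) ((2 * ρ + 1) * B + q + 1) ↔ (p < ρ ↔ q < ρ) := by
  rw [BlockDiagonal, Nat.add_sub_cancel, Nat.add_sub_cancel, Nat.mul_add_mod, Nat.mul_add_mod,
    Nat.mod_eq_of_lt hp, Nat.mod_eq_of_lt hq]

/-- A king move lowers both coordinate distances to the centre (ρ, ρ) at once. When both coordinates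
must change, the cell crossed has its diagonal in the right direction by the choice of
`BlockDiagonal`. -/
theorem exists_step_towards_centre {ρ p q j : ℕ} (A B : ℕ) (hp : p < 2 * ρ + 1)
    (hq : q < 2 * ρ + 1) (hp1 : p ≤ ρ + (j + 1)) (hp2 : ρ ≤ p + (j + 1)) (hq1 : q ≤ ρ + (j + 1))
    (hq2 : ρ ≤ q + (j + 1)) :
    ∃ p' q', (p' < 2 * ρ + 1 ∧ q' < 2 * ρ + 1) ∧ (p' ≤ ρ + j ∧ ρ ≤ p' + j) ∧
      (q' ≤ ρ + j ∧ ρ ≤ q' + j) ∧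
      ((p' = p ∧ q' = q) ∨
      LatticeStep (BlockDiagonal ρ) ((2 * ρ + 1) * A + p, (2 * ρ + 1) * B + q)
        ((2 * ρ + 1) * A + p', (2 * ρ + 1) * B + q') ∨
      LatticeStep (BlockDiagonal ρ) ((2 * ρ + 1) * A + p', (2 * ρ + 1) * B + q')
        ((2 * ρ + 1) * A + p, (2 * ρ + 1) * B + q)) := by
  rcases lt_trichotomy p ρ with h1 | h1 | h1 <;> rcases lt_trichotomy q ρ with h2 | h2 | h2
  · exact ⟨p + 1, q + 1, by omega, by omega, by omega, .inr (.inl (.inr (.inr (.inl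
      ⟨rfl, rfl, (blockDiagonal_succ A B hp hq).2 (iff_of_true h1 h2)⟩))))⟩
  · exact ⟨p + 1, q, by omega, by omega, by omega, .inr (.inl (.inl ⟨rfl, rfl⟩))⟩
  · obtain ⟨q, rfl⟩ := Nat.exists_eq_succ_of_ne_zero (Nat.ne_zero_of_lt h2)
    exact ⟨p + 1, q, by omega, by omega, by omega, .inr (.inl (.inr (.inr (.inr
      ⟨rfl, rfl, fun h => by
        have := (blockDiagonal_succ A B hp (by omega : q < 2 * ρ + 1)).1 h
        omega⟩))))⟩
  · exact ⟨p, q + 1, by omega, by omega, by omega, .inr (.inl (.inr (.inl ⟨rfl, rfl⟩)))⟩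
  · exact ⟨p, q, by omega, by omega, by omega, .inl ⟨rfl, rfl⟩⟩
  · obtain ⟨q, rfl⟩ := Nat.exists_eq_succ_of_ne_zero (Nat.ne_zero_of_lt h2)
    exact ⟨p, q, by omega, by omega, by omega, .inr (.inr (.inr (.inl ⟨rfl, rfl⟩)))⟩
  · obtain ⟨p, rfl⟩ := Nat.exists_eq_succ_of_ne_zero (Nat.ne_zero_of_lt h1)
    exact ⟨p, q + 1, by omega, by omega, by omega, .inr (.inr (.inr (.inr (.inr
      ⟨rfl, rfl, fun h => by
        have := (blockDiagonal_succ A B (by omega : p < 2 * ρ + 1) hq).1 h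
        omega⟩))))⟩
  · obtain ⟨p, rfl⟩ := Nat.exists_eq_succ_of_ne_zero (Nat.ne_zero_of_lt h1)
    exact ⟨p, q, by omega, by omega, by omega, .inr (.inr (.inl ⟨rfl, rfl⟩))⟩
  · obtain ⟨p, rfl⟩ := Nat.exists_eq_succ_of_ne_zero (Nat.ne_zero_of_lt h1)
    obtain ⟨q, rfl⟩ := Nat.exists_eq_succ_of_ne_zero (Nat.ne_zero_of_lt h2)
    exact ⟨p, q, by omega, by omega, by omega, .inr (.inr (.inr (.inr (.inl
      ⟨rfl, rfl, (blockDiagonal_succ A B (by omega : p < 2 * ρ + 1) (by omega : q < 2 * ρ + 1)).2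
        (by omega)⟩))))⟩

theorem block_index_lt {m k A p : ℕ} (hA : A < k) (hp : p < m) : m * A + p < m * k :=
  calc m * A + p < m * A + m := by omega
    _ = m * (A + 1) := by ring
    _ ≤ m * k := Nat.mul_le_mul_left _ hA

/-- The centre of the block with index `b`. -/
def blockCentre (ρ k : ℕ) (b : Fin k × Fin k) :
    Fin ((2 * ρ + 1) * k) × Fin ((2 * ρ + 1) * k) :=
  (⟨(2 * ρ + 1) * b.1 + ρ, block_index_lt b.1.2 (by omega)⟩,
    ⟨(2 * ρ + 1) * b.2 + ρ, block_index_lt b.2.2 (by omega)⟩)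

theorem blockCentre_injective (ρ k : ℕ) : Function.Injective (blockCentre ρ k) := by
  rintro ⟨a, b⟩ ⟨a', b'⟩ h
  simp only [blockCentre, Prod.mk.injEq, Fin.mk.injEq, Nat.add_right_cancel_iff] at h
  exact Prod.ext (Fin.ext (Nat.eq_of_mul_eq_mul_left (by omega) h.1))
    (Fin.ext (Nat.eq_of_mul_eq_mul_left (by omega) h.2))

/-- The triangulated grid of `k × k` blocks of side `2 * ρ + 1`, with an apex adjacent to the
centres of the blocks. -/
def blockGraph (ρ k : ℕ) :
    SimpleGraph (Option (Fin ((2 * ρ + 1) * k) × Fin ((2 * ρ + 1) * k))) :=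
  addApex (triangulatedGrid (BlockDiagonal ρ) ((2 * ρ + 1) * k)) (Set.range (blockCentre ρ k))

/-- Here j bounds the king-move distance to the block centre; the extra 1 is the edge from the
centre to the apex. -/
theorem edist_apex_le {ρ k : ℕ} (A B : Fin k) (j : ℕ) : ∀ p q : ℕ, ∀ (hp : p < 2 * ρ + 1)
    (hq : q < 2 * ρ + 1), p ≤ ρ + j → ρ ≤ p + j → q ≤ ρ + j → ρ ≤ q + j →
    (blockGraph ρ k).edist none (some (⟨(2 * ρ + 1) * A + p, block_index_lt A.2 hp⟩,
      ⟨(2 * ρ + 1) * B + q, block_index_lt B.2 hq⟩)) ≤ (j + 1 : ℕ) := by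
  induction j with
  | zero =>
    intro p q hp hq h1 h2 h3 h4
    obtain rfl : p = ρ := by omega
    obtain rfl : q = p := by omega
    exact edist_le_one_iff_adj_or_eq.2 (.inl ⟨(A, B), rfl⟩)
  | succ j ih =>
    intro p q hp hq h1 h2 h3 h4
    obtain ⟨p', q', ⟨hp', hq'⟩, h1', h2', h⟩ :=
      exists_step_towards_centre (A : ℕ) (B : ℕ) hp hq h1 h2 h3 h4
    refine (SimpleGraph.edist_triangle (v := some (⟨(2 * ρ + 1) * A + p', block_index_lt A.2 hp'⟩,
      ⟨(2 * ρ + 1) * B + q', block_index_lt B.2 hq'⟩))).trans ?_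
    rw [Nat.cast_succ (j + 1)]
    refine add_le_add (ih p' q' hp' hq' h1'.1 h1'.2 h2'.1 h2'.2) ?_
    rw [edist_le_one_iff_adj_or_eq]
    rcases h with ⟨rfl, rfl⟩ | h
    · exact .inr rfl
    · exact .inl h.symm

theorem radius_blockGraph_le (ρ k : ℕ) : (blockGraph ρ k).radius ≤ (ρ + 1 : ℕ) := by
  refine radius_le_eccent.trans ((eccent_le_iff none _).2 fun v => ?_)
  rcases v with - | ⟨⟨x, hx⟩, ⟨y, hy⟩⟩
  · simp
  · have hp := Nat.mod_lt x (by omega : 2 * ρ + 1 > 0)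
    have hq := Nat.mod_lt y (by omega : 2 * ρ + 1 > 0)
    have := edist_apex_le (k := k) ⟨x / (2 * ρ + 1), Nat.div_lt_of_lt_mul hx⟩
      ⟨y / (2 * ρ + 1), Nat.div_lt_of_lt_mul hy⟩ ρ (x % (2 * ρ + 1)) (y % (2 * ρ + 1)) hp hq
      (by omega) (by omega) (by omega) (by omega)
    simpa only [Nat.div_add_mod] using this

theorem eulerGenus_blockGraph_le (ρ k : ℕ) : (blockGraph ρ k).eulerGenus ≤ (2 * (k * k) : ℕ) := by
  have h := eulerGenus_addApex_le (BlockDiagonal ρ)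
    (fun i : Fin (k * k) => blockCentre ρ k (finProdFinEquiv.symm i))
    ((blockCentre_injective ρ k).comp finProdFinEquiv.symm.injective)
  rwa [show (fun i : Fin (k * k) => blockCentre ρ k (finProdFinEquiv.symm i)) =
    blockCentre ρ k ∘ finProdFinEquiv.symm from rfl, finProdFinEquiv.symm.surjective.range_comp] at h

theorem not_isMinor_blockGraph (ρ k : ℕ) {t : ℕ} (ht : 4 ≤ t) (hk : 2 * (k * k) < t) :
    ¬ (completeBipartiteGraph (Fin 3) (Fin t)).IsMinor (blockGraph ρ k) := by
  classical
  have h := not_isMinor_addApex (triangulatedGrid_hasFaceLabellings (BlockDiagonal ρ)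
    ((2 * ρ + 1) * k) (Fin 2 → Fin 2 → ZMod 2) fun a => by
      funext p q
      exact CharTwo.add_self_eq_zero _) (Finset.univ.image (blockCentre ρ k)) ht (by
      rwa [Finset.card_image_of_injective _ (blockCentre_injective ρ k), Finset.card_univ,
        Fintype.card_prod, Fintype.card_fin])
  rwa [Finset.coe_image, Finset.coe_univ, Set.image_univ] at h

theorem gridGraph_isContained_triangulatedGrid (d : ℕ → ℕ → Prop) (n : ℕ) :
    (gridGraph n n).IsContained (triangulatedGrid d n) := by
  refine ⟨⟨⟨id, fun {u v} h => ?_⟩, Function.injective_id⟩⟩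
  change |(u.1 : ℤ) - (v.1 : ℤ)| + |(u.2 : ℤ) - (v.2 : ℤ)| = 1 at h
  change LatticeStep d _ _ ∨ LatticeStep d _ _
  simp only [LatticeStep, id]
  rcases abs_cases ((u.1 : ℤ) - (v.1 : ℤ)) with ⟨h1, h1'⟩ | ⟨h1, h1'⟩ <;>
    rcases abs_cases ((u.2 : ℤ) - (v.2 : ℤ)) with ⟨h2, h2'⟩ | ⟨h2, h2'⟩ <;>
    rw [h1, h2] at h <;> omega

theorem isContained_addApex {U : Type*} (T : SimpleGraph U) (N : Set U) :
    T.IsContained (addApex T N) :=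
  ⟨⟨⟨some, fun h => h⟩, Option.some_injective _⟩⟩

end SimpleGraph

theorem mainTheorem3 (g r : ℕ) (hg : 2 ≤ g) (hr : 1 ≤ r) :
    ∃ (V : Type) (_ : Fintype V) (G : SimpleGraph V),
      G.radius ≤ (r : ℕ∞) ∧
      G.eulerGenus ≤ (g : ℕ∞) ∧
      ¬ (completeBipartiteGraph (Fin 3) (Fin (2 * g + 3))).IsMinor G ∧
      (gridGraph ((2 * r - 1) * ⌊Real.sqrt ((g : ℝ) / 2)⌋₊)
        ((2 * r - 1) * ⌊Real.sqrt ((g : ℝ) / 2)⌋₊)).IsContained G := by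
  obtain ⟨ρ, rfl⟩ : ∃ ρ, r = ρ + 1 := ⟨r - 1, by omega⟩
  rw [show 2 * (ρ + 1) - 1 = 2 * ρ + 1 by omega]
  generalize hk : ⌊Real.sqrt ((g : ℝ) / 2)⌋₊ = k
  have hkg : 2 * (k * k) ≤ g := by
    have h1 : (k : ℝ) ≤ Real.sqrt ((g : ℝ) / 2) := hk ▸ Nat.floor_le (Real.sqrt_nonneg _)
    have h2 : (k : ℝ) * k ≤ (g : ℝ) / 2 := by
      calc (k : ℝ) * k ≤ Real.sqrt ((g : ℝ) / 2) * Real.sqrt ((g : ℝ) / 2) :=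
            mul_self_le_mul_self k.cast_nonneg h1
        _ = (g : ℝ) / 2 := Real.mul_self_sqrt (by positivity)
    have h3 : (2 * (k * k) : ℝ) ≤ g := by linarith
    exact_mod_cast h3
  exact ⟨_, inferInstance, blockGraph ρ k, radius_blockGraph_le ρ k,
    (eulerGenus_blockGraph_le ρ k).trans (by exact_mod_cast hkg),
    not_isMinor_blockGraph ρ k (by omega) (by omega),
    (gridGraph_isContained_triangulatedGrid _ _).trans (isContained_addApex _ _)⟩
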